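/- A partition is a finite non-increasing sequence of positive integers $\lambda=(\lambda_1,\dots,\lambda_m)$ (the empty partition, $m=0$, included); its size is $\lambda_1+\cdots+\lambda_m$, and its Ferrers–Young diagram has $\lambda_i$ dots in the $i$-th row. The hook number of a dot is the number of dots directly below it and directly to the right of it, the dot itself included. A partition is a $5$-core if none of its hook numbers is divisible by $5$. Let $A_{5,4}(n)$ be the number of ordered $4$-tuples $(\Lambda_1,\Lambda_2,\Lambda_3,\Lambda_4)$ of $5$-core partitions whose sizes add up to $n$. **Theorem.** For all integers $n\ge 0$ and $\alpha\ge 1$, $$A_{5,4}\left(5^{\alpha+1}n+5^{\alpha+1}-4\right)\equiv 0 \pmod{5^{\alpha+4}}.$$ -/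

import Mathlib

/-- The hook number of a dot `c` of the Ferrers-Young diagram `μ`: the number of dots of `μ` directly
to the right of `c` in its row or directly below `c` in its column, `c` itself included.
(Coordinates are `(row, column)`, both counted from `0`.) -/
def hookNumber (μ : YoungDiagram) (c : ℕ × ℕ) : ℕ :=
  (μ.cells.filter fun d =>
    (d.1 = c.1 ∧ c.2 ≤ d.2) ∨ (d.2 = c.2 ∧ c.1 ≤ d.1)).card

/-- A partition, given by its Ferrers-Young diagram, is a `t`-core if none of its hook numbers is
divisible by `t`. -/
def IsTCore (t : ℕ) (μ : YoungDiagram) : Prop :=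
  ∀ c ∈ μ.cells, ¬ t ∣ hookNumber μ c

/-- The partition `k`-tuples of `n` all of whose entries are `t`-cores: ordered `k`-tuples of
partitions, possibly empty, whose sizes add up to `n`. A partition is given by its Ferrers-Young
diagram; its size is the number of dots. -/
def coreTuples (t k n : ℕ) : Set (Fin k → YoungDiagram) :=
  {Λ | ∑ i, (Λ i).card = n ∧ ∀ i, IsTCore t (Λ i)}

/-- There are finitely many such tuples, so that their number `Set.ncard` is meaningful. -/
theorem coreTuples_finite (t k n : ℕ) : (coreTuples t k n).Finite := by
  have hbox : ∀ (μ : YoungDiagram), μ.card ≤ n →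
      μ.cells ⊆ Finset.range n ×ˢ Finset.range n := by
    rintro μ hμ ⟨i, j⟩ hc
    have hc' : (i, j) ∈ μ := hc
    have hr : μ.rowLen i ≤ μ.card := by
      rw [YoungDiagram.rowLen_eq_card]
      exact Finset.card_le_card (Finset.filter_subset _ _)
    have hl : μ.colLen j ≤ μ.card := by
      rw [YoungDiagram.colLen_eq_card]
      exact Finset.card_le_card (Finset.filter_subset _ _)
    have h1 := YoungDiagram.mem_iff_lt_rowLen.1 hc'
    have h2 := YoungDiagram.mem_iff_lt_colLen.1 hc'
    simp only [Finset.mem_product, Finset.mem_range]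
    omega
  have hfin : {μ : YoungDiagram | μ.card ≤ n}.Finite := by
    refine Set.Finite.of_finite_image (f := YoungDiagram.cells) ?_ ?_
    · refine ((Finset.range n ×ˢ Finset.range n).powerset.finite_toSet).subset ?_
      rintro _ ⟨μ, hμ, rfl⟩
      exact Finset.mem_coe.2 (Finset.mem_powerset.2 (hbox μ hμ))
    · intro μ _ ν _ h
      exact YoungDiagram.ext h
  refine (Set.Finite.pi' fun _ : Fin k => hfin).subset ?_
  intro Λ hΛ i
  have h := Finset.single_le_sum (f := fun i => (Λ i).card) (fun _ _ => Nat.zero_le _)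
    (Finset.mem_univ i)
  exact h.trans hΛ.1.le

/-- `tupleCoreCount t k n` is `A_{t,k}(n)`, the number of partition `k`-tuples of `n` with
`t`-cores. -/
noncomputable def tupleCoreCount (t k n : ℕ) : ℕ :=
  (coreTuples t k n).ncard

/-! Write E(q) = ∏ (1 - q^n) and let U keep the coefficients with index divisible by 5, reindexed
(`dissect 0`). The generating function of 5-cores is E(q^5)^5 / E(q), so A_{5,4}(n) is the
coefficient of q^(n+4) in b4 = q^4 E(q^5)^20 / E(q)^4. The numbers in the theorem are coefficients
of U^(α+1) b4, and it suffices that this series is divisible by 5^(α+4).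

The series b_i = q^i E(q^5)^(6i-4) / E(q)^(6i-20), for i = 1, ..., 4, span a U-stable space
(`dissect_eta_quotients`): U b4 = 5^7 b4 + 12500 b3 + 550 b2 + 4 b1, U b3 = -b1, U b2 = -5^3 b2, U
b1 = -5^6 b3. Two applications to b4 produce 5^5, and each further one a new factor 5
(`iterate_dissect_eta_quotient`).

The matrix of U is found without modular forms. The pentagonal number theorem splits E into three
residue classes mod 5, E = a - F - c with F = q E(q^25), and an involution on pairs of pentagonal
numbers gives ac = F^2 (`dissection_mul`). Hence E is a root of a quintic whose coefficients are
polynomials in F and a series in q^5 (`euler_quintic`). The product of E over its conjugates q ↦ ζq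
identifies that series (`eulerNorm_mul`). Applying U to multiples of the quintic gives a linear
recurrence, solved from five explicit values.

The generating function comes from the abacus: 5-cores correspond to flush bead configurations on
five runners, and these are counted by splitting Euler's expansion of ∏ (1 + q^i z) by i mod 5
(`coeff_core_product`, `ncard_cores`). -/

open PowerSeries in
/-- The subseries of `f` on the exponents `≡ r (mod 5)`, reindexed: `∑ aₙ Xⁿ` becomes
`∑ a₅ₙ₊ᵣ Xⁿ`. -/
noncomputable def dissect {R : Type*} [CommRing R] (r : ℕ) : R⟦X⟧ →ₗ[R] R⟦X⟧ where
  toFun f := PowerSeries.mk fun n => coeff (5 * n + r) f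
  map_add' f g := by ext; simp
  map_smul' a f := by ext; simp

namespace CoreSeries

open PowerSeries Finset

/-! ### Dissection of power series modulo 5 -/

section Dissection

variable {R : Type*} [CommRing R]

/-- The substitution `X ↦ X ^ 5`. -/
noncomputable abbrev expand5 : R⟦X⟧ →ₐ[R] R⟦X⟧ := PowerSeries.expand 5 (by norm_num)

@[simp] theorem coeff_dissect (r n : ℕ) (f : R⟦X⟧) :
    coeff n (dissect r f) = coeff (5 * n + r) f := by
  simp [dissect]

theorem dissect_expand_mul {r : ℕ} (hr : r < 5) (g f : R⟦X⟧) :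
    dissect r (expand5 g * f) = g * dissect r f := by
  ext n
  rw [coeff_dissect, coeff_mul, coeff_mul]
  symm
  refine Finset.sum_of_injOn (fun x => (5 * x.1, 5 * x.2 + r)) ?_ ?_ ?_ ?_
  · rintro ⟨a, b⟩ - ⟨c, d⟩ - h
    simp only [Prod.mk.injEq] at h ⊢
    omega
  · rintro ⟨a, b⟩ h
    simp only [mem_coe, HasAntidiagonal.mem_antidiagonal] at h ⊢
    omega
  · rintro ⟨a, b⟩ h h'
    by_cases ha : 5 ∣ a
    · obtain ⟨c, rfl⟩ := ha
      exfalso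
      apply h'
      simp only [HasAntidiagonal.mem_antidiagonal] at h
      refine ⟨(c, n - c), ?_, ?_⟩
      · simp only [mem_coe, HasAntidiagonal.mem_antidiagonal]; omega
      · exact Prod.ext rfl (show 5 * (n - c) + r = b by omega)
    · rw [coeff_expand_of_not_dvd _ _ _ ha, zero_mul]
  · rintro ⟨a, b⟩ -
    simp

theorem dissect_expand (g : R⟦X⟧) : dissect 0 (expand5 g) = g := by
  ext n; simp [coeff_expand_mul]

theorem dissect_zero_X_pow (j i : ℕ) (hi : i < 5) (g : R⟦X⟧) :
    dissect 0 (X ^ (5 * j + i) * expand5 g) = if i = 0 then X ^ j * g else 0 := by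
  have h : (X ^ (5 * j + i) * expand5 g : R⟦X⟧) = expand5 (X ^ j * g) * X ^ i := by
    rw [map_mul, map_pow, expand_X]; ring
  rw [h, dissect_expand_mul (by norm_num)]
  have h2 : dissect 0 (X ^ i : R⟦X⟧) = if i = 0 then 1 else 0 := by
    ext n
    rw [coeff_dissect, coeff_X_pow]
    split_ifs with h1 h2 h2
    · rw [coeff_one, if_pos (by omega)]
    · omega
    · rw [coeff_one, if_neg (by omega)]
    · simp
  rw [h2]
  split_ifs <;> simp

theorem coeff_X_pow_mul_expand (r : ℕ) (hr : r < 5) (g : R⟦X⟧) (n : ℕ) :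
    coeff n (X ^ r * expand5 g) = if n % 5 = r then coeff (n / 5) g else 0 := by
  rw [coeff_X_pow_mul']
  split_ifs with h1 h2 h2
  · rw [coeff_expand, if_pos (by omega)]; congr 2; omega
  · rw [coeff_expand, if_neg (by omega)]
  · omega
  · rfl

theorem coeff_X_pow_mul_expand_dissect (r : ℕ) (hr : r < 5) (f : R⟦X⟧) (n : ℕ) :
    coeff n (X ^ r * expand5 (dissect r f)) = if n % 5 = r then coeff n f else 0 := by
  rw [coeff_X_pow_mul_expand r hr]
  split_ifs with h
  · rw [coeff_dissect]; congr 2; omega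
  · rfl

end Dissection

/-! ### The 5-dissection of Euler's product -/

section Pentagonal

theorem natAbs_le_pentagonal (k : ℤ) : k.natAbs ≤ pentagonal k := by
  have h := two_mul_natCast_pentagonal k
  zify
  rcases abs_cases k with ⟨h1, h2⟩ | ⟨h1, h2⟩ <;> rw [h1]
  · rcases h2.eq_or_lt with h3 | h3
    · omega
    · nlinarith
  · nlinarith

/-- One index window serves all n ≤ N, so that squares of the series become finite double sums. -/
theorem coeff_pentagonalSeries_eq_sum (R : Type*) [CommRing R] {n N : ℕ} (hn : n ≤ N) :
    coeff n (pentagonalSeries R) =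
      ∑ k ∈ Icc (-N : ℤ) N, if pentagonal k = n then ((k.negOnePow : ℤ) : R) else 0 := by
  by_cases h : n ∈ Set.range pentagonal
  · obtain ⟨k, rfl⟩ := h
    rw [coeff_pentagonalSeries_pentagonal, Finset.sum_eq_single k]
    · simp
    · intro l _ hl
      rw [if_neg]
      exact fun h => hl (pentagonal_injective h)
    · intro hk
      exfalso; apply hk
      have := natAbs_le_pentagonal k
      rw [mem_Icc]; omega
  · rw [coeff_pentagonalSeries_eq_zero R h, Finset.sum_eq_zero]
    intro k _
    rw [if_neg]
    exact fun hk => h ⟨k, hk⟩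

theorem map_pentagonalSeries {R S : Type*} [CommRing R] [CommRing S] (f : R →+* S) :
    PowerSeries.map f (pentagonalSeries R) = pentagonalSeries S := by
  ext n
  rw [coeff_map, coeff_pentagonalSeries_eq_sum R le_rfl, coeff_pentagonalSeries_eq_sum S le_rfl,
    map_sum]
  refine Finset.sum_congr rfl fun k _ => ?_
  split_ifs <;> simp

theorem coeff_mul_of_coeff_eq_sum {R : Type*} [CommRing R] {ι : Type*} (s : Finset ι) (p : ι → ℕ)
    (u : ι → R) (f : R⟦X⟧) (N : ℕ)
    (hf : ∀ n ≤ N, coeff n f = ∑ k ∈ s, if p k = n then u k else 0) :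
    coeff N (f * f) = ∑ x ∈ s ×ˢ s, if p x.1 + p x.2 = N then u x.1 * u x.2 else 0 := by
  have h1 : coeff N (f * f) =
      coeff N ((∑ k ∈ s, C (u k) * X ^ p k) * (∑ k ∈ s, C (u k) * X ^ p k)) := by
    have h2 : ∀ n ≤ N, coeff n (∑ k ∈ s, C (u k) * X ^ p k) = coeff n f := by
      intro n hn
      rw [hf n hn, map_sum]
      refine Finset.sum_congr rfl fun k _ => ?_
      rw [coeff_C_mul, coeff_X_pow]
      simp [eq_comm]
    rw [coeff_mul, coeff_mul]
    refine Finset.sum_congr rfl fun x hx => ?_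
    rw [HasAntidiagonal.mem_antidiagonal] at hx
    rw [h2 _ (by omega), h2 _ (by omega)]
  rw [h1, Finset.sum_mul_sum, ← Finset.sum_product', map_sum]
  refine Finset.sum_congr rfl fun x _ => ?_
  rw [show C (u x.1) * X ^ p x.1 * (C (u x.2) * X ^ p x.2) =
    C (u x.1 * u x.2) * X ^ (p x.1 + p x.2) by rw [map_mul, pow_add]; ring,
    coeff_C_mul, coeff_X_pow]
  simp [eq_comm]

/-- Squared version of the pentagonal exponent, without division. -/
theorem twentyfour_mul_pentagonal (k : ℤ) : 24 * (pentagonal k : ℤ) + 1 = (6 * k - 1) ^ 2 := by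
  linear_combination 12 * two_mul_natCast_pentagonal k

/-- With u = 6k - 1 and v = 6l - 1 the exponent condition reads u^2 + v^2 = 24N + 2. The reflection
(u, v) ↦ ((-3u - 4v)/5, (-4u + 3v)/5) preserves this form, and the congruence, which says u ≡ 2v mod
5, makes it integral. It flips the parity of k + l, so the signs cancel in pairs. -/
theorem sum_pentagonal_norm_eq_zero (N : ℕ) :
    ∑ x ∈ Icc (-N : ℤ) N ×ˢ Icc (-N : ℤ) N with
      pentagonal x.1 + pentagonal x.2 = N ∧ (x.1 - 2 * x.2 + 1) % 5 = 0,
      ((x.1.negOnePow : ℤ) * (x.2.negOnePow : ℤ) : ℤ) = 0 := by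
  refine Finset.sum_involution
    (fun x _ => ((-3 * x.1 - 4 * x.2 + 2) / 5, (3 * x.2 - 4 * x.1 + 1) / 5)) ?_ ?_ ?_ ?_
  · rintro ⟨k, l⟩ h
    simp only [mem_filter] at h
    obtain ⟨j, hj⟩ : ∃ j, k = 2 * l - 1 + 5 * j := ⟨(k - 2 * l + 1) / 5, by omega⟩
    have e1 : (-3 * k - 4 * l + 2) / 5 = -2 * l + 1 - 3 * j := by omega
    have e2 : (3 * l - 4 * k + 1) / 5 = - l + 1 - 4 * j := by omega
    simp only [e1, e2]
    rw [← Units.val_mul, ← Units.val_mul, ← Int.negOnePow_add, ← Int.negOnePow_add, hj]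
    rw [show -2 * l + 1 - 3 * j + (-l + 1 - 4 * j) = 2 * l - 1 + 5 * j + l +
      (2 * (-3 * l + 1 - 6 * j) + 1) by ring, Int.negOnePow_add _ (2 * (-3 * l + 1 - 6 * j) + 1),
      Int.negOnePow_odd _ ⟨_, rfl⟩]
    simp
  · rintro ⟨k, l⟩ h -
    simp only [mem_filter] at h
    simp only [ne_eq, Prod.mk.injEq]
    omega
  · rintro ⟨k, l⟩ h
    simp only [mem_filter, mem_product, mem_Icc] at h ⊢
    obtain ⟨-, h2, h3⟩ := h
    obtain ⟨j, hj⟩ : ∃ j, k = 2 * l - 1 + 5 * j := ⟨(k - 2 * l + 1) / 5, by omega⟩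
    have e1 : (-3 * k - 4 * l + 2) / 5 = -2 * l + 1 - 3 * j := by omega
    have e2 : (3 * l - 4 * k + 1) / 5 = - l + 1 - 4 * j := by omega
    simp only [e1, e2]
    have h4 : pentagonal (-2 * l + 1 - 3 * j) + pentagonal (-l + 1 - 4 * j) = N := by
      rw [← h2, hj]
      zify
      have a1 := twentyfour_mul_pentagonal (-2 * l + 1 - 3 * j)
      have a2 := twentyfour_mul_pentagonal (-l + 1 - 4 * j)
      have a3 := twentyfour_mul_pentagonal (2 * l - 1 + 5 * j)
      have a4 := twentyfour_mul_pentagonal l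
      have : (24 : ℤ) ≠ 0 := by norm_num
      apply mul_left_cancel₀ this
      linear_combination a1 + a2 - a3 - a4
    have b1 := natAbs_le_pentagonal (-2 * l + 1 - 3 * j)
    have b2 := natAbs_le_pentagonal (-l + 1 - 4 * j)
    refine ⟨⟨⟨?_, ?_⟩, ?_, ?_⟩, h4, ?_⟩ <;> omega
  · rintro ⟨k, l⟩ h
    simp only [mem_filter] at h
    simp only [Prod.mk.injEq]
    omega

theorem sum_pentagonal_norm_eq_zero' (N : ℕ) :
    ∑ x ∈ Icc (-N : ℤ) N ×ˢ Icc (-N : ℤ) N with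
      pentagonal x.1 + pentagonal x.2 = N ∧ (x.2 - 2 * x.1 + 1) % 5 = 0,
      ((x.1.negOnePow : ℤ) * (x.2.negOnePow : ℤ) : ℤ) = 0 := by
  refine Eq.trans ?_ (sum_pentagonal_norm_eq_zero N)
  refine Finset.sum_nbij' Prod.swap Prod.swap ?_ ?_ ?_ ?_ ?_
  · rintro ⟨k, l⟩ h
    simp only [mem_filter, mem_product, mem_Icc, Prod.swap] at h ⊢
    omega
  · rintro ⟨k, l⟩ h
    simp only [mem_filter, mem_product, mem_Icc, Prod.swap] at h ⊢
    omega
  · simp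
  · simp
  · rintro ⟨k, l⟩ h
    simp [mul_comm]

theorem pentagonal_mod_five (k : ℤ) : (pentagonal k : ℤ) % 5 = k * (3 * k - 1) * 3 % 5 := by
  have := two_mul_natCast_pentagonal k
  omega

theorem pentagonal_mod_five_cases (k : ℤ) :
    (k % 5 = 0 ∧ pentagonal k % 5 = 0) ∨ (k % 5 = 1 ∧ pentagonal k % 5 = 1) ∨
    (k % 5 = 2 ∧ pentagonal k % 5 = 0) ∨ (k % 5 = 3 ∧ pentagonal k % 5 = 2) ∨
    (k % 5 = 4 ∧ pentagonal k % 5 = 2) := by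
  have h := pentagonal_mod_five k
  have h5 : k % 5 = 0 ∨ k % 5 = 1 ∨ k % 5 = 2 ∨ k % 5 = 3 ∨ k % 5 = 4 := by omega
  rcases h5 with h5 | h5 | h5 | h5 | h5 <;>
    simp [Int.mul_emod, Int.sub_emod, h5] at h <;> omega

theorem coeff_dissect_one_part {n N : ℕ} (hn : n ≤ N) :
    coeff n (X ^ 1 * expand5 (dissect 1 (pentagonalSeries ℤ))) =
      ∑ k ∈ Icc (-N : ℤ) N, if pentagonal k = n then
        (if k % 5 = 1 then (k.negOnePow : ℤ) else 0) else 0 := by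
  rw [coeff_X_pow_mul_expand_dissect 1 (by norm_num), coeff_pentagonalSeries_eq_sum ℤ hn]
  split_ifs with h
  · refine Finset.sum_congr rfl fun k _ => ?_
    split_ifs with h1 h2
    · rfl
    · have := pentagonal_mod_five_cases k; omega
    · rfl
  · symm
    apply Finset.sum_eq_zero
    intro k _
    split_ifs with h1 h2
    · have := pentagonal_mod_five_cases k; omega
    · rfl
    · rfl

/-- For N ≡ 2 mod 5, u^2 + v^2 ≡ 0 forces u ≡ 2v or v ≡ 2u mod 5. Each of the two classes has signed
sum 0, and they overlap exactly in the pairs with both indices ≡ 1 mod 5. By inclusion-exclusion the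
full sum is minus the sum over the overlap. -/
theorem coeff_pentagonalSeries_sq {N : ℕ} (hN : N % 5 = 2) :
    coeff N (pentagonalSeries ℤ * pentagonalSeries ℤ) =
      - coeff N ((X ^ 1 * expand5 (dissect 1 (pentagonalSeries ℤ))) *
        (X ^ 1 * expand5 (dissect 1 (pentagonalSeries ℤ)))) := by
  rw [coeff_mul_of_coeff_eq_sum _ _ _ _ N (fun n hn => coeff_dissect_one_part hn),
    coeff_mul_of_coeff_eq_sum _ _ _ _ N (fun n hn => coeff_pentagonalSeries_eq_sum ℤ hn)]
  have h1 := sum_pentagonal_norm_eq_zero N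
  have h2 := sum_pentagonal_norm_eq_zero' N
  rw [Finset.sum_filter] at h1 h2
  rw [eq_neg_iff_add_eq_zero, ← Finset.sum_add_distrib]
  refine Eq.trans ?_ ((congrArg₂ (· + ·) h1 h2).trans (add_zero 0))
  rw [← Finset.sum_add_distrib]
  refine Finset.sum_congr rfl fun x _ => ?_
  by_cases hx : pentagonal x.1 + pentagonal x.2 = N
  · simp only [hx, true_and, if_true]
    have c1 := pentagonal_mod_five_cases x.1
    have c2 := pentagonal_mod_five_cases x.2
    by_cases d1 : (x.1 - 2 * x.2 + 1) % 5 = 0 <;> by_cases d2 : (x.2 - 2 * x.1 + 1) % 5 = 0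
    · rw [if_pos d1, if_pos d2, if_pos (by omega), if_pos (by omega)]; simp only [Int.cast_id]
    · rw [if_pos d1, if_neg d2]
      by_cases e : x.1 % 5 = 1
      · rw [if_neg (show ¬ x.2 % 5 = 1 by omega)]; simp only [Int.cast_id, mul_zero, add_zero]
      · rw [if_neg e]; simp only [Int.cast_id, zero_mul, add_zero]
    · rw [if_neg d1, if_pos d2]
      by_cases e : x.1 % 5 = 1
      · rw [if_neg (show ¬ x.2 % 5 = 1 by omega)]; simp only [Int.cast_id, mul_zero, add_zero, zero_add]
      · rw [if_neg e]; simp only [Int.cast_id, zero_mul, add_zero, zero_add]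
    · omega
  · simp [hx]

theorem pentagonal_one_sub_five_mul (m : ℤ) :
    pentagonal (1 - 5 * m) = 5 * (5 * pentagonal m) + 1 := by
  zify
  have a1 := twentyfour_mul_pentagonal (1 - 5 * m)
  have a2 := twentyfour_mul_pentagonal m
  apply mul_left_cancel₀ (show (24 : ℤ) ≠ 0 by norm_num)
  linear_combination a1 - 25 * a2

theorem dissect_one_pentagonalSeries :
    dissect 1 (pentagonalSeries ℤ) = - expand5 (pentagonalSeries ℤ) := by
  ext n
  rw [coeff_dissect, map_neg, coeff_expand]
  by_cases h : ∃ m : ℤ, n = 5 * pentagonal m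
  · obtain ⟨m, rfl⟩ := h
    rw [← pentagonal_one_sub_five_mul, coeff_pentagonalSeries_pentagonal, if_pos ⟨_, rfl⟩,
      Nat.mul_div_cancel_left _ (by norm_num), coeff_pentagonalSeries_pentagonal,
      show 1 - 5 * m = m + (2 * (-3 * m) + 1) by ring, Int.negOnePow_add,
      Int.negOnePow_odd _ ⟨_, rfl⟩]
    simp
  · rw [coeff_pentagonalSeries_eq_zero]
    · split_ifs with h5
      · rw [coeff_pentagonalSeries_eq_zero, neg_zero]
        rintro ⟨m, hm⟩
        exact h ⟨m, by omega⟩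
      · simp
    · rintro ⟨k, hk⟩
      have := pentagonal_mod_five_cases k
      obtain ⟨m, rfl⟩ : ∃ m, k = 1 - 5 * m := ⟨(1 - k) / 5, by omega⟩
      rw [pentagonal_one_sub_five_mul] at hk
      exact h ⟨m, by omega⟩

/-- The Euler product `∏ (1 - X ^ n)`. -/
noncomputable abbrev euler : ℤ⟦X⟧ := pentagonalSeries ℤ

theorem euler_eq_dissection :
    euler = expand5 (dissect 0 euler) - X * expand5 (expand5 euler)
      + X ^ 2 * expand5 (dissect 2 euler) := by
  have h0 := fun n => coeff_X_pow_mul_expand_dissect 0 (by norm_num) euler n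
  have h1 := fun n => coeff_X_pow_mul_expand_dissect 1 (by norm_num) euler n
  have h2 := fun n => coeff_X_pow_mul_expand_dissect 2 (by norm_num) euler n
  simp only [pow_zero, one_mul, pow_one, dissect_one_pentagonalSeries, map_neg, mul_neg] at h0 h1
  ext n
  rw [map_add, map_sub, h0, h2, sub_eq_add_neg, h1]
  by_cases hn : n ∈ Set.range pentagonal
  · obtain ⟨k, rfl⟩ := hn
    have := pentagonal_mod_five_cases k
    have h : pentagonal k % 5 = 0 ∨ pentagonal k % 5 = 1 ∨ pentagonal k % 5 = 2 := by omega
    rcases h with h | h | h <;> simp [h]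
  · simp [coeff_pentagonalSeries_eq_zero ℤ hn]

/-- In E^2 the exponents ≡ 2 mod 5 come from twice the product of the outer parts plus the square of
the middle part; by `coeff_pentagonalSeries_sq` this equals minus the square of the middle part. -/
theorem dissection_mul :
    expand5 (dissect 0 euler) * (X ^ 2 * expand5 (dissect 2 euler)) =
      - (X * expand5 (expand5 euler)) ^ 2 := by
  set a := expand5 (dissect 0 euler) with ha
  set b : ℤ⟦X⟧ := expand5 euler with hb
  set c := dissect 2 euler with hc
  rw [eq_neg_iff_add_eq_zero]
  have h1 : a * (X ^ 2 * expand5 c) + (X * expand5 b) ^ 2 =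
      X ^ 2 * expand5 (dissect 0 euler * c + b ^ 2) := by
    rw [map_add, map_mul, map_pow, ha]; ring
  rw [h1]
  have h0 : euler * euler + (X * expand5 b) ^ 2 = X ^ 0 * expand5 (dissect 0 euler ^ 2)
      + X ^ 1 * expand5 (-2 * dissect 0 euler * b) +
      2 * (X ^ 2 * expand5 (dissect 0 euler * c + b ^ 2))
      + X ^ 3 * expand5 (- 2 * b * c) + X ^ 4 * expand5 (c ^ 2) := by
    conv_lhs => rw [euler_eq_dissection]
    simp only [map_add, map_mul, map_pow, map_neg, map_ofNat, ← ha, ← hb, ← hc]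
    ring
  ext n
  rw [map_zero]
  by_cases hn : n % 5 = 2
  · have h2 := coeff_pentagonalSeries_sq hn
    rw [dissect_one_pentagonalSeries, map_neg, ← hb] at h2
    have h3 := congrArg (coeff n) h0
    rw [two_mul] at h3
    simp only [map_add] at h3
    rw [coeff_X_pow_mul_expand 0 (by norm_num), coeff_X_pow_mul_expand 1 (by norm_num),
      coeff_X_pow_mul_expand 3 (by norm_num), coeff_X_pow_mul_expand 4 (by norm_num), h2] at h3
    have h4 : (X ^ 1 * -expand5 b * (X ^ 1 * -expand5 b) : ℤ⟦X⟧) = (X * expand5 b) ^ 2 := by ring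
    rw [h4] at h3
    simp [hn] at h3
    simp only [map_add, map_mul, map_pow]
    linarith
  · rw [coeff_X_pow_mul_expand 2 (by norm_num), if_neg hn]

end Pentagonal

end CoreSeries

namespace CoreSeries

open PowerSeries Finset

/-! ### The norm over fifth roots of unity and the quintic equation -/

section ModularEquation

theorem prod_five_conjugates {R : Type*} [CommRing R] {ω : R}
    (hω : 1 + ω + ω ^ 2 + ω ^ 3 + ω ^ 4 = 0) (a b c : R) :
    ∏ k ∈ range 5, (a - ω ^ k * b - (ω ^ k) ^ 2 * c) =
      (a - b - c) * ((a ^ 2 + b ^ 2 + c ^ 2) ^ 2 - (a ^ 2 + b ^ 2 + c ^ 2) * (b * c - a * b - a * c)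
        - (b * c - a * b) ^ 2 - (a * c) ^ 2 - 3 * (b * c - a * b) * (a * c)) := by
  have h5 : ω ^ 5 - 1 = 0 := by linear_combination (ω - 1) * hω
  -- Gaussian periods: pairing ω with ω^4 and ω^2 with ω^3 leaves factors over ℤ[s], with s + t = s
  -- t = -1.
  set s := ω + ω ^ 4 with hs
  set t := ω ^ 2 + ω ^ 3 with ht
  have h14 : (a - ω * b - ω ^ 2 * c) * (a - ω ^ 4 * b - (ω ^ 4) ^ 2 * c) =
      (a ^ 2 + b ^ 2 + c ^ 2) + s * (b * c - a * b) - t * (a * c) := by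
    rw [hs, ht]
    linear_combination (b ^ 2 + b * c * (ω ^ 4 + ω) + c ^ 2 * (ω ^ 5 + 1) - a * c * ω ^ 3) * h5
  have h23 : (a - ω ^ 2 * b - (ω ^ 2) ^ 2 * c) * (a - ω ^ 3 * b - (ω ^ 3) ^ 2 * c) =
      (a ^ 2 + b ^ 2 + c ^ 2) + t * (b * c - a * b) - s * (a * c) := by
    rw [hs, ht]
    linear_combination (b ^ 2 + b * c * (ω ^ 3 + ω ^ 2) + c ^ 2 * (ω ^ 5 + 1) - a * c * ω) * h5
  have hst : s + t = -1 := by rw [hs, ht]; linear_combination hω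
  have hst' : s * t = -1 := by rw [hs, ht]; linear_combination (ω + ω ^ 2) * h5 + hω
  have hstt : t = -1 - s := by linear_combination hst
  simp only [Finset.prod_range_succ, Finset.prod_range_zero, pow_zero, pow_one, one_mul, one_pow]
  calc _ = (a - b - c) * (((a - ω * b - ω ^ 2 * c) * (a - ω ^ 4 * b - (ω ^ 4) ^ 2 * c)) *
        ((a - ω ^ 2 * b - (ω ^ 2) ^ 2 * c) * (a - ω ^ 3 * b - (ω ^ 3) ^ 2 * c))) := by ring
    _ = _ := by
      rw [h14, h23]
      rw [hstt] at hst' ⊢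
      have hs2 : s ^ 2 = 1 - s := by linear_combination -hst'
      linear_combination ((a - b - c) * (-(b * c - a * b) ^ 2 - (a * c) ^ 2
        - 2 * (b * c - a * b) * (a * c))) * hs2

theorem prod_five_conjugates_of_mul_eq_sq {R : Type*} [CommRing R] {ω : R}
    (hω : 1 + ω + ω ^ 2 + ω ^ 3 + ω ^ 4 = 0) {a b c : R} (h : a * c = b ^ 2) :
    ∏ k ∈ range 5, (a - ω ^ k * b - (ω ^ k) ^ 2 * c) = a ^ 5 - 11 * b ^ 5 - c ^ 5 := by
  rw [prod_five_conjugates hω]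
  linear_combination (-10 * b ^ 3 - 5 * a * b * c) * h

theorem prod_one_sub_root_mul {R : Type*} [CommRing R] {ω : R}
    (hω : 1 + ω + ω ^ 2 + ω ^ 3 + ω ^ 4 = 0) (y : R) :
    ∏ k ∈ range 5, (1 - ω ^ k * y) = 1 - y ^ 5 := by
  have h := prod_five_conjugates hω 1 y 0
  simp only [mul_zero, sub_zero] at h
  rw [h]
  ring

open scoped PowerSeries.WithPiTopology

theorem continuous_rescale {R : Type*} [CommRing R] [TopologicalSpace R] [IsTopologicalRing R]
    (c : R) : Continuous (PowerSeries.rescale c) := by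
  rw [continuous_iff_continuousAt]
  intro f
  rw [ContinuousAt, WithPiTopology.tendsto_iff_coeff_tendsto]
  intro d
  simp only [coeff_rescale]
  exact ((WithPiTopology.continuous_coeff R d).tendsto f).const_mul _

theorem continuous_expand {R : Type*} [CommRing R] [TopologicalSpace R] (p : ℕ) (hp : p ≠ 0) :
    Continuous (PowerSeries.expand p hp : R⟦X⟧ → R⟦X⟧) := by
  rw [continuous_iff_continuousAt]
  intro f
  rw [ContinuousAt, WithPiTopology.tendsto_iff_coeff_tendsto]
  intro d
  simp only [coeff_expand]
  split_ifs
  · exact (WithPiTopology.continuous_coeff R _).tendsto f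
  · exact tendsto_const_nhds

theorem rescale_expand {R : Type*} [CommRing R] {c : R} {p : ℕ} (hp : p ≠ 0) (hc : c ^ p = 1)
    (f : R⟦X⟧) : rescale c (PowerSeries.expand p hp f) = PowerSeries.expand p hp f := by
  ext n
  rw [coeff_rescale, coeff_expand]
  split_ifs with h
  · obtain ⟨m, rfl⟩ := h
    rw [pow_mul, hc, one_pow, one_mul]
  · simp

theorem hasProd_expand_pentagonalSeries :
    HasProd (fun n => (1 - X ^ (5 * (n + 1)) : ℂ⟦X⟧)) (expand5 (pentagonalSeries ℂ)) := by
  have h := (WithPiTopology.hasProd_one_sub_X_pow ℂ).map (expand5 (R := ℂ))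
    (continuous_expand 5 (by norm_num))
  convert h using 2 with n
  simp [pow_mul]

theorem hasProd_ite_dvd {R : Type*} [CommRing R] [TopologicalSpace R] {f : ℕ → R⟦X⟧} {a : R⟦X⟧}
    (h : HasProd (fun n => f (5 * (n + 1))) a) :
    HasProd (fun n => if 5 ∣ n + 1 then f (n + 1) else 1) a := by
  have hinj : Function.Injective (fun n : ℕ => 5 * n + 4) := fun a b h => by
    simp only at h; omega
  rw [← hinj.hasProd_iff]
  · convert h using 2 with n
    simp only [Function.comp]
    rw [if_pos (by omega)]
    congr 1
  · intro n hn
    rw [if_neg]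
    rintro ⟨m, hm⟩
    exact hn ⟨m - 1, by simp only; omega⟩

theorem one_add_root_pow {ζ : ℂ} (hζ : IsPrimitiveRoot ζ 5) {n : ℕ} (hn : ¬ 5 ∣ n) :
    1 + ζ ^ n + (ζ ^ n) ^ 2 + (ζ ^ n) ^ 3 + (ζ ^ n) ^ 4 = 0 := by
  have h1 : ζ ^ n ≠ 1 := fun h => hn (hζ.pow_eq_one_iff_dvd n |>.1 h)
  have h2 : (ζ ^ n) ^ 5 = 1 := by rw [← pow_mul, mul_comm, pow_mul, hζ.pow_eq_one, one_pow]
  apply mul_left_cancel₀ (sub_ne_zero.2 h1)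
  linear_combination h2

/-- Factor by factor: 1 - X^n has norm 1 - X^(5n) when 5 ∤ n, and (1 - X^n)^5 when 5 ∣ n. The factor
E(q^25) supplies the missing 1 - X^(5n) with 5 ∣ n, and the multiples of 5 contribute five copies of
E(q^5). -/
theorem prod_rescale_pentagonalSeries {ζ : ℂ} (hζ : IsPrimitiveRoot ζ 5) :
    (∏ k ∈ range 5, rescale (ζ ^ k) (pentagonalSeries ℂ)) * expand5 (expand5 (pentagonalSeries ℂ))
      = expand5 (pentagonalSeries ℂ) ^ 6 := by
  have h1 : HasProd (fun n => ∏ k ∈ range 5, rescale (ζ ^ k) (1 - X ^ (n + 1) : ℂ⟦X⟧))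
      (∏ k ∈ range 5, rescale (ζ ^ k) (pentagonalSeries ℂ)) :=
    hasProd_prod fun k _ => (WithPiTopology.hasProd_one_sub_X_pow ℂ).map (rescale (ζ ^ k))
      (continuous_rescale _)
  have h2 : HasProd (fun n => if 5 ∣ n + 1 then (1 - X ^ (5 * (n + 1)) : ℂ⟦X⟧) else 1)
      (expand5 (expand5 (pentagonalSeries ℂ))) := by
    apply hasProd_ite_dvd (f := fun n => (1 - X ^ (5 * n) : ℂ⟦X⟧))
    have h := hasProd_expand_pentagonalSeries.map (expand5 (R := ℂ))
      (continuous_expand 5 (by norm_num))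
    convert h using 2 with n
    simp [pow_mul]
  have h3 : HasProd (fun n => if 5 ∣ n + 1 then (1 - X ^ (n + 1) : ℂ⟦X⟧) else 1)
      (expand5 (pentagonalSeries ℂ)) :=
    hasProd_ite_dvd (f := fun n => (1 - X ^ n : ℂ⟦X⟧)) hasProd_expand_pentagonalSeries
  have h4 := hasProd_expand_pentagonalSeries.mul (h3.mul (h3.mul (h3.mul (h3.mul h3))))
  have h5 := h1.mul h2
  suffices h : _ = _ from h.trans (show expand5 (pentagonalSeries ℂ) * (expand5 (pentagonalSeries ℂ)
    * (expand5 (pentagonalSeries ℂ) * (expand5 (pentagonalSeries ℂ) * (expand5 (pentagonalSeries ℂ)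
    * expand5 (pentagonalSeries ℂ))))) = _ by ring)
  refine h5.unique ?_
  convert h4 using 2 with n
  have hr : ∀ k, rescale (ζ ^ k) (1 - X ^ (n + 1) : ℂ⟦X⟧) =
      1 - C ((ζ ^ (n + 1)) ^ k) * X ^ (n + 1) := by
    intro k
    rw [map_sub, map_one, map_pow, rescale_X, mul_pow, ← map_pow, ← pow_mul, ← pow_mul, mul_comm k]
  simp only [hr]
  split_ifs with hn
  · obtain ⟨m, hm⟩ := hn
    rw [hm, pow_mul ζ, hζ.pow_eq_one]
    simp only [one_pow, map_one, one_mul, prod_const, card_range]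
    ring
  · have h6 := prod_one_sub_root_mul (ω := (C (ζ ^ (n + 1)) : ℂ⟦X⟧)) (by
      simpa using congrArg (C (R := ℂ)) (one_add_root_pow hζ hn)) (X ^ (n + 1))
    simp only [map_pow] at h6 ⊢
    rw [h6]
    ring

theorem dissect_zero_mul_dissect_two :
    dissect 0 euler * dissect 2 euler = - expand5 euler ^ 2 := by
  -- Both sides are X^2 times a series in X^5; the factor X^3 moves them into residue class 0.
  have h := congrArg (fun f => dissect 0 (X ^ 3 * f)) dissection_mul
  beta_reduce at h
  have e1 : (X ^ 3 * (expand5 (dissect 0 euler) * (X ^ 2 * expand5 (dissect 2 euler))) : ℤ⟦X⟧) =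
      X ^ (5 * 1 + 0) * expand5 (dissect 0 euler * dissect 2 euler) := by
    rw [map_mul]; ring
  have e2 : (X ^ 3 * -(X * expand5 (expand5 euler)) ^ 2 : ℤ⟦X⟧) =
      X ^ (5 * 1 + 0) * expand5 (- expand5 euler ^ 2) := by
    rw [map_neg, map_pow]; ring
  rw [e1, e2, dissect_zero_X_pow 1 0 (by norm_num), dissect_zero_X_pow 1 0 (by norm_num)] at h
  simp only [if_true] at h
  exact mul_left_cancel₀ (pow_ne_zero 1 X_ne_zero) h

/-- `A ^ 5 - 11 q B ^ 5 - q ^ 2 C ^ 5` for the dissection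
`euler q = A (q ^ 5) - q B (q ^ 5) - q ^ 2 C (q ^ 5)`. -/
noncomputable def eulerNorm : ℤ⟦X⟧ :=
  dissect 0 euler ^ 5 - 11 * X * expand5 euler ^ 5 + X ^ 2 * dissect 2 euler ^ 5

/-- The norm of E over q ↦ ζ^k q is computed twice: from the dissection, whose parts satisfy ac =
b^2, and from the infinite product. The identity is proved over ℂ after q ↦ q^5, and both embeddings
are injective. -/
theorem eulerNorm_mul : eulerNorm * expand5 euler = euler ^ 6 := by
  obtain ⟨ζ, hζ⟩ : ∃ ζ : ℂ, IsPrimitiveRoot ζ 5 := ⟨_, Complex.isPrimitiveRoot_exp 5 (by norm_num)⟩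
  let φ : ℤ⟦X⟧ →+* ℂ⟦X⟧ := PowerSeries.map (Int.castRingHom ℂ)
  have hφ : Function.Injective φ := PowerSeries.map_injective _ (by
    simpa using Int.cast_injective)
  have hexp : Function.Injective (expand5 (R := ℤ)) := by
    intro f g h
    rw [← dissect_expand f, h, dissect_expand]
  apply hexp
  apply hφ
  have hE : φ euler = pentagonalSeries ℂ := map_pentagonalSeries _
  have hcomm : ∀ f : ℤ⟦X⟧, φ (expand5 f) = expand5 (φ f) := fun f => map_expand 5 _ _ f
  have hX : φ X = X := PowerSeries.map_X _
  set a := φ (expand5 (dissect 0 euler)) with ha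
  set b := φ (X * expand5 (expand5 euler)) with hb
  set c := - φ (X ^ 2 * expand5 (dissect 2 euler)) with hc
  have habc : a * c = b ^ 2 := by
    rw [ha, hb, hc, mul_neg, ← map_mul, dissection_mul]; simp
  have key := prod_rescale_pentagonalSeries hζ
  have hres : ∀ k, rescale (ζ ^ k) (pentagonalSeries ℂ) =
      a - C ζ ^ k * b - (C ζ ^ k) ^ 2 * c := by
    intro k
    have hk : (ζ ^ k) ^ 5 = 1 := by rw [← pow_mul, mul_comm, pow_mul, hζ.pow_eq_one, one_pow]
    rw [← hE, euler_eq_dissection, ha, hb, hc]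
    simp only [map_add, map_sub, map_mul, map_pow, hcomm, hX, rescale_X,
      rescale_expand (by norm_num) hk]
    ring
  simp only [hres] at key
  rw [prod_five_conjugates_of_mul_eq_sq (by
      simpa using congrArg (C (R := ℂ)) (one_add_root_pow hζ (n := 1) (by norm_num))) habc] at key
  rw [eulerNorm]
  simp only [map_add, map_sub, map_mul, map_pow, hcomm, hX, expand_X, map_ofNat, hE] at key ha hb hc ⊢
  rw [← key, ha, hb, hc]
  ring

/-- Modulo ac = F^2, the norm a^5 - 11F^5 - c^5 is a polynomial in E = a - F - c and F alone. -/
theorem euler_quintic :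
    let F : ℤ⟦X⟧ := X * expand5 (expand5 euler)
    euler ^ 5 + 5 * euler ^ 4 * F + 15 * euler ^ 3 * F ^ 2 + 25 * euler ^ 2 * F ^ 3
      + 25 * euler * F ^ 4 = expand5 eulerNorm := by
  intro F
  have hF : F = X * expand5 (expand5 euler) := rfl
  clear_value F
  have h1 := dissection_mul
  have h2 := euler_eq_dissection
  rw [eulerNorm]
  simp only [map_add, map_sub, map_mul, map_pow, map_ofNat, expand_X]
  set a := expand5 (dissect 0 euler)
  set c' := expand5 (dissect 2 euler)
  set b' := expand5 (expand5 euler)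
  set e := euler
  clear_value a c' b' e
  subst h2
  obtain ⟨c, hc⟩ : ∃ c, c = -(X ^ 2 * c') := ⟨_, rfl⟩
  have h3 : a * c = F ^ 2 := by rw [hc, hF]; linear_combination -h1
  have e1 : a - X * b' + X ^ 2 * c' = a - F - c := by rw [hc, hF]; ring
  have e2 : a ^ 5 - 11 * X ^ 5 * b' ^ 5 + (X ^ 5) ^ 2 * c' ^ 5 = a ^ 5 - 11 * F ^ 5 - c ^ 5 := by
    rw [hc, hF]; ring
  rw [e1, e2]
  linear_combination (5 * c ^ 3 + 5 * F ^ 2 * c - 10 * a * c ^ 2 - 5 * a * F ^ 2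
    + 10 * a ^ 2 * c - 5 * a ^ 3) * h3

end ModularEquation

end CoreSeries

namespace CoreSeries

open PowerSeries Finset

/-! ### The action of U on the four eta quotients -/

section HeckeAction

theorem isUnit_euler : IsUnit euler := by
  rw [PowerSeries.isUnit_iff_constantCoeff, ← coeff_zero_eq_constantCoeff_apply]
  have h := coeff_pentagonalSeries_pentagonal ℤ 0
  rw [show pentagonal 0 = 0 from rfl] at h
  rw [h]
  simp

theorem dissect_zero_X_pow_mul (m : ℕ) (g : ℤ⟦X⟧) :
    dissect 0 (X ^ m * expand5 g) = if m % 5 = 0 then X ^ (m / 5) * g else 0 := by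
  conv_lhs => rw [← Nat.div_add_mod m 5]
  exact dissect_zero_X_pow _ _ (Nat.mod_lt _ (by norm_num)) g

/-- The values of the fifth-root trace on `F ^ 15, …, F ^ 11 * euler ^ 4`, `F` the middle term of
the dissection of `euler`. -/
theorem dissect_powers :
    let F : ℤ⟦X⟧ := X * expand5 (expand5 euler)
    let K : ℤ⟦X⟧ := X ^ 3 * expand5 euler ^ 15
    dissect 0 (F ^ 15) = K ∧ dissect 0 (F ^ 14 * euler) = -K ∧
    dissect 0 (F ^ 13 * euler ^ 2) = -K ∧ dissect 0 (F ^ 12 * euler ^ 3) = 5 * K ∧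
    dissect 0 (F ^ 11 * euler ^ 4) = -5 * K := by
  intro F K
  have hF : F = X * expand5 (expand5 euler) := rfl
  have hK : K = X ^ 3 * expand5 euler ^ 15 := rfl
  clear_value F K
  have hac := dissect_zero_mul_dissect_two
  have h2 := euler_eq_dissection
  set a := dissect 0 euler
  set c := dissect 2 euler
  set b := expand5 euler
  set e := euler
  clear_value a c b e
  subst h2 hF hK
  have e0 : (X * expand5 b) ^ 15 = X ^ 15 * expand5 (b ^ 15) := by simp only [map_pow]; ring
  have e1 : (X * expand5 b) ^ 14 * (expand5 a - X * expand5 b + X ^ 2 * expand5 c) =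
      X ^ 14 * expand5 (b ^ 14 * a) + X ^ 15 * expand5 (- b ^ 15) + X ^ 16 * expand5 (b ^ 14 * c) := by
    simp only [map_pow, map_mul, map_neg]; ring
  have e2 : (X * expand5 b) ^ 13 * (expand5 a - X * expand5 b + X ^ 2 * expand5 c) ^ 2 =
      X ^ 13 * expand5 (b ^ 13 * a ^ 2) + X ^ 14 * expand5 (-2 * b ^ 14 * a)
      + X ^ 15 * expand5 (b ^ 15 + 2 * b ^ 13 * a * c) + X ^ 16 * expand5 (-2 * b ^ 14 * c)
      + X ^ 17 * expand5 (b ^ 13 * c ^ 2) := by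
    simp only [map_pow, map_mul, map_neg, map_add, map_ofNat]; ring
  have e3 : (X * expand5 b) ^ 12 * (expand5 a - X * expand5 b + X ^ 2 * expand5 c) ^ 3 =
      X ^ 12 * expand5 (b ^ 12 * a ^ 3) + X ^ 13 * expand5 (-3 * b ^ 13 * a ^ 2)
      + X ^ 14 * expand5 (b ^ 12 * (3 * a * b ^ 2 + 3 * a ^ 2 * c))
      + X ^ 15 * expand5 (-b ^ 12 * (b ^ 3 + 6 * a * b * c))
      + X ^ 16 * expand5 (b ^ 12 * (3 * b ^ 2 * c + 3 * a * c ^ 2))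
      + X ^ 17 * expand5 (-3 * b ^ 13 * c ^ 2) + X ^ 18 * expand5 (b ^ 12 * c ^ 3) := by
    simp only [map_pow, map_mul, map_neg, map_add, map_ofNat]; ring
  have e4 : (X * expand5 b) ^ 11 * (expand5 a - X * expand5 b + X ^ 2 * expand5 c) ^ 4 =
      X ^ 11 * expand5 (b ^ 11 * a ^ 4) + X ^ 12 * expand5 (-4 * b ^ 12 * a ^ 3)
      + X ^ 13 * expand5 (b ^ 11 * (6 * a ^ 2 * b ^ 2 + 4 * a ^ 3 * c))
      + X ^ 14 * expand5 (-b ^ 11 * (4 * a * b ^ 3 + 12 * a ^ 2 * b * c))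
      + X ^ 15 * expand5 (b ^ 11 * (b ^ 4 + 12 * a * b ^ 2 * c + 6 * a ^ 2 * c ^ 2))
      + X ^ 16 * expand5 (-b ^ 11 * (4 * b ^ 3 * c + 12 * a * b * c ^ 2))
      + X ^ 17 * expand5 (b ^ 11 * (6 * b ^ 2 * c ^ 2 + 4 * a * c ^ 3))
      + X ^ 18 * expand5 (-4 * b ^ 12 * c ^ 3) + X ^ 19 * expand5 (b ^ 11 * c ^ 4) := by
    simp only [map_pow, map_mul, map_neg, map_add, map_ofNat]; ring
  rw [e0, e1, e2, e3, e4]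
  simp only [map_add (dissect 0), dissect_zero_X_pow_mul]
  norm_num
  refine ⟨?_, ?_, ?_⟩
  · linear_combination 2 * X ^ 3 * b ^ 13 * hac
  · linear_combination (-6) * X ^ 3 * b ^ 13 * hac
  · linear_combination X ^ 3 * b ^ 11 * (12 * b ^ 2 + 6 * (a * c - b ^ 2)) * hac

/-- This is U applied to the quintic times F^(j+5) G. Both F^5 and the right side of the quintic are
series in X^5, so they pass through U; `eulerNorm_mul` then rewrites the norm. -/
theorem dissect_recurrence (G : ℤ⟦X⟧) (j : ℕ) :
    let F : ℤ⟦X⟧ := X * expand5 (expand5 euler)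
    X * expand5 euler ^ 6 * (dissect 0 (F ^ j * euler ^ 5 * G)
      + 5 * dissect 0 (F ^ (j + 1) * euler ^ 4 * G) + 15 * dissect 0 (F ^ (j + 2) * euler ^ 3 * G)
      + 25 * dissect 0 (F ^ (j + 3) * euler ^ 2 * G)
      + 25 * dissect 0 (F ^ (j + 4) * euler ^ 1 * G)) =
    euler ^ 6 * dissect 0 (F ^ (j + 5) * G) := by
  intro F
  have hq := euler_quintic
  have hF5 : F ^ 5 = expand5 (X * expand5 euler ^ 5) := by
    simp only [F, map_mul, map_pow, expand_X]; ring
  have h1 : expand5 (X * expand5 euler ^ 5) * (F ^ j * euler ^ 5 * G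
      + 5 • (F ^ (j + 1) * euler ^ 4 * G) + 15 • (F ^ (j + 2) * euler ^ 3 * G)
      + 25 • (F ^ (j + 3) * euler ^ 2 * G) + 25 • (F ^ (j + 4) * euler ^ 1 * G)) =
      expand5 eulerNorm * (F ^ (j + 5) * G) := by
    rw [← hF5, ← hq]
    simp only [nsmul_eq_mul]
    push_cast
    ring
  have h2 := congrArg (dissect 0) h1
  rw [dissect_expand_mul (by norm_num), dissect_expand_mul (by norm_num)] at h2
  simp only [map_add, map_nsmul] at h2
  simp only [nsmul_eq_mul] at h2
  push_cast at h2
  rw [← eulerNorm_mul]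
  linear_combination expand5 euler * h2

/-- Solving the quintic recurrence upwards and downwards from its five initial values. -/
theorem recurrence_solution {A : Type*} [CommRing A] [IsDomain A] {t y K : A} (ht : t ≠ 0)
    {S : ℕ → A}
    (h : ∀ k ≤ 13, t * (S (k + 5) + 5 * S (k + 4) + 15 * S (k + 3) + 25 * S (k + 2)
      + 25 * S (k + 1)) = y * S k)
    (h4 : S 4 = K) (h5 : S 5 = -K) (h6 : S 6 = -K) (h7 : S 7 = 5 * K) (h8 : S 8 = -5 * K) :
    y ^ 4 * S 0 = (78125 * t ^ 4 + 12500 * t ^ 3 * y + 550 * t ^ 2 * y ^ 2 + 4 * t * y ^ 3) * K ∧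
    S 6 = -K ∧ S 12 = -125 * K ∧ S 18 = - 15625 * K := by
  have r (k : ℕ) (hk : k ≤ 13) := h k hk
  have r3 := r 3 (by norm_num)
  have r2 := r 2 (by norm_num)
  have r1 := r 1 (by norm_num)
  have r0 := r 0 (by norm_num)
  have r4 := r 4 (by norm_num)
  have r5 := r 5 (by norm_num)
  have r6 := r 6 (by norm_num)
  have r7 := r 7 (by norm_num)
  have r8 := r 8 (by norm_num)
  have r9 := r 9 (by norm_num)
  have r10 := r 10 (by norm_num)
  have r11 := r 11 (by norm_num)
  have r12 := r 12 (by norm_num)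
  have r13 := r 13 (by norm_num)
  norm_num only [] at r0 r1 r2 r3 r4 r5 r6 r7 r8 r9 r10 r11 r12 r13
  rw [h5, h6, h7, h8, h4] at r3
  rw [h5, h6, h7, h4] at r2
  rw [h5, h6, h4] at r1
  rw [h5, h4] at r0
  rw [h5, h6, h7, h8, h4] at r4
  rw [h5, h6, h7, h8] at r5
  rw [h6, h7, h8] at r6
  rw [h7, h8] at r7
  rw [h8] at r8
  -- Downwards each step divides by y, upwards the recurrence divides by t. Denominators are kept
  -- cleared; at the indices 12 and 18 the powers of t cancel.
  have s3 : y * S 3 = 5 * t * K := by linear_combination -r3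
  have s2 : y ^ 2 * S 2 = (125 * t ^ 2 + 10 * t * y) * K := by
    linear_combination -y * r2 + 25 * t * s3
  have s1 : y ^ 3 * S 1 = (3125 * t ^ 3 + 375 * t ^ 2 * y + 9 * t * y ^ 2) * K := by
    linear_combination -y ^ 2 * r1 + 25 * t * s2 + 25 * t * y * s3
  have s0 : y ^ 4 * S 0 =
      (78125 * t ^ 4 + 12500 * t ^ 3 * y + 550 * t ^ 2 * y ^ 2 + 4 * t * y ^ 3) * K := by
    linear_combination -y ^ 3 * r0 + 25 * t * s1 + 25 * t * y * s2 + 15 * t * y ^ 2 * s3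
  have s9 : t * S 9 = y * K := by linear_combination r4
  have s10 : t * S 10 = (-6 * y - 25 * t) * K := by linear_combination r5 - 5 * s9
  have s11 : t * S 11 = (14 * y + 125 * t) * K := by linear_combination r6 - 5 * s10 - 15 * s9
  have s12 : S 12 = -125 * K := mul_left_cancel₀ ht (by
    linear_combination r7 - 5 * s11 - 15 * s10 - 25 * s9)
  have s13 : t * S 13 = (-90 * y - 625 * t) * K := by
    linear_combination r8 - 5 * t * s12 - 15 * s11 - 25 * s10 - 25 * s9
  have s14 : t ^ 2 * S 14 = (y ^ 2 + 250 * y * t + 2500 * t ^ 2) * K := by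
    linear_combination t * r9 + y * s9 - 5 * t * s13 - 15 * t ^ 2 * s12 - 25 * t * s11
      - 25 * t * s10
  have s15 : t ^ 2 * S 15 = (-11 * y ^ 2 - 275 * y * t - 3125 * t ^ 2) * K := by
    linear_combination t * r10 + y * s10 - 5 * s14 - 15 * t * s13 - 25 * t ^ 2 * s12 - 25 * t * s11
  have s16 : t ^ 2 * S 16 = (54 * y ^ 2 - 3125 * t ^ 2) * K := by
    linear_combination t * r11 + y * s11 - 5 * s15 - 15 * s14 - 25 * t * s13 - 25 * t ^ 2 * s12
  have s17 : t ^ 2 * S 17 = (-130 * y ^ 2 + 15625 * t ^ 2) * K := by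
    linear_combination t * r12 + t * y * s12 - 5 * s16 - 15 * s15 - 25 * s14 - 25 * t * s13
  have s18 : S 18 = -15625 * K := mul_left_cancel₀ (pow_ne_zero 2 ht) (by
    linear_combination t * r13 + y * s13 - 5 * s17 - 15 * s16 - 25 * s15 - 25 * s14)
  exact ⟨s0, h6, s12, s18⟩

theorem dissect_eta_quotients {I : ℤ⟦X⟧} (hI : euler * I = 1) :
    let E₅ : ℤ⟦X⟧ := expand5 euler
    dissect 0 (X ^ 4 * E₅ ^ 20 * I ^ 4) = 78125 * (X ^ 4 * E₅ ^ 20 * I ^ 4)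
      + 12500 * (X ^ 3 * E₅ ^ 14 * euler ^ 2) + 550 * (X ^ 2 * E₅ ^ 8 * euler ^ 8)
      + 4 * (X * E₅ ^ 2 * euler ^ 14) ∧
    dissect 0 (X ^ 3 * E₅ ^ 14 * euler ^ 2) = -(X * E₅ ^ 2 * euler ^ 14) ∧
    dissect 0 (X ^ 2 * E₅ ^ 8 * euler ^ 8) = -125 * (X ^ 2 * E₅ ^ 8 * euler ^ 8) ∧
    dissect 0 (X * E₅ ^ 2 * euler ^ 14) = -15625 * (X ^ 3 * E₅ ^ 14 * euler ^ 2) := by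
  intro E₅
  have hE₅ : expand5 euler = E₅ := rfl
  have hE0 : euler ≠ 0 := isUnit_euler.ne_zero
  have hE5 : E₅ ≠ 0 := by
    have := isUnit_euler.map (expand5 (R := ℤ))
    exact this.ne_zero
  have hX : (X : ℤ⟦X⟧) ≠ 0 := X_ne_zero
  set F : ℤ⟦X⟧ := X * expand5 (expand5 euler) with hF
  have hII : ∀ n, euler ^ n * I ^ n = 1 := fun n => by rw [← mul_pow, hI, one_pow]
  obtain ⟨p0, p1, p2, p3, p4⟩ := dissect_powers
  simp only [← hF] at p0 p1 p2 p3 p4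
  -- S k is U of F^(19-k) E^(k-4). For k = 4, ..., 8 these are the values in `dissect_powers`; for k
  -- = 0, 6, 12, 18 the argument is b4, b3, b2, b1 up to powers of X^5, E(q^5) and E(q^25), which
  -- pass through U.
  obtain ⟨s0, s6, s12, s18⟩ := recurrence_solution (t := X * E₅ ^ 6) (y := euler ^ 6)
    (K := X ^ 3 * E₅ ^ 15) (S := fun k => dissect 0 (F ^ (19 - k) * euler ^ k * I ^ 4))
    (mul_ne_zero hX (pow_ne_zero _ hE5)) (by
      intro k hk
      have h := dissect_recurrence (euler ^ k * I ^ 4) (14 - k)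
      simp only [← hF] at h
      have e1 : 14 - k + 1 = 15 - k := by omega
      have e2 : 14 - k + 2 = 16 - k := by omega
      have e3 : 14 - k + 3 = 17 - k := by omega
      have e4 : 14 - k + 4 = 18 - k := by omega
      have e5 : 14 - k + 5 = 19 - k := by omega
      have f1 : 19 - (k + 1) = 18 - k := by omega
      have f2 : 19 - (k + 2) = 17 - k := by omega
      have f3 : 19 - (k + 3) = 16 - k := by omega
      have f4 : 19 - (k + 4) = 15 - k := by omega
      have f5 : 19 - (k + 5) = 14 - k := by omega
      rw [e1, e2, e3, e4, e5, hE₅] at h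
      simp only [f1, f2, f3, f4, f5, pow_add euler k]
      convert h using 1 <;> ring_nf)
    (by
      simp only [Nat.reduceSub]
      rw [mul_assoc, hII, mul_one]; exact p0)
    (by
      simp only [Nat.reduceSub]
      rw [← p1]; refine congrArg (dissect 0) ?_; linear_combination F ^ 14 * euler * hII 4)
    (by
      simp only [Nat.reduceSub]
      rw [← p2]; refine congrArg (dissect 0) ?_; linear_combination F ^ 13 * euler ^ 2 * hII 4)
    (by
      simp only [Nat.reduceSub]
      rw [← p3]; refine congrArg (dissect 0) ?_; linear_combination F ^ 12 * euler ^ 3 * hII 4)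
    (by
      simp only [Nat.reduceSub]
      rw [← p4]; refine congrArg (dissect 0) ?_; linear_combination F ^ 11 * euler ^ 4 * hII 4)
  have q4 : dissect 0 (X ^ 4 * E₅ ^ 20 * I ^ 4) =
      euler ^ 20 * dissect 0 (X ^ 4 * I ^ 4) := by
    rw [← dissect_expand_mul (by norm_num)]
    refine congrArg (dissect 0) ?_; simp only [E₅, map_pow]; ring
  have q3 : dissect 0 (X ^ 3 * E₅ ^ 14 * euler ^ 2) =
      euler ^ 14 * dissect 0 (X ^ 3 * euler ^ 2) := by
    rw [← dissect_expand_mul (by norm_num)]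
    refine congrArg (dissect 0) ?_; simp only [E₅, map_pow]; ring
  have q2 : dissect 0 (X ^ 2 * E₅ ^ 8 * euler ^ 8) =
      euler ^ 8 * dissect 0 (X ^ 2 * euler ^ 8) := by
    rw [← dissect_expand_mul (by norm_num)]
    refine congrArg (dissect 0) ?_; simp only [E₅, map_pow]; ring
  have q1 : dissect 0 (X * E₅ ^ 2 * euler ^ 14) =
      euler ^ 2 * dissect 0 (X * euler ^ 14) := by
    rw [← dissect_expand_mul (by norm_num)]
    refine congrArg (dissect 0) ?_; simp only [E₅, map_pow]; ring
  have t4 : dissect 0 (F ^ (19 - 0) * euler ^ 0 * I ^ 4) =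
      X ^ 3 * E₅ ^ 19 * dissect 0 (X ^ 4 * I ^ 4) := by
    rw [← dissect_expand_mul (by norm_num)]
    refine congrArg (dissect 0) ?_; simp only [hF, E₅, map_pow, map_mul, expand_X]; ring
  have t3 : dissect 0 (F ^ (19 - 6) * euler ^ 6 * I ^ 4) =
      X ^ 2 * E₅ ^ 13 * dissect 0 (X ^ 3 * euler ^ 2) := by
    rw [← dissect_expand_mul (by norm_num)]
    refine congrArg (dissect 0) ?_; simp only [hF, E₅, map_pow, map_mul, expand_X]
    linear_combination X ^ 13 * expand5 (expand5 euler) ^ 13 * euler ^ 2 * hII 4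
  have t2 : dissect 0 (F ^ (19 - 12) * euler ^ 12 * I ^ 4) =
      X * E₅ ^ 7 * dissect 0 (X ^ 2 * euler ^ 8) := by
    rw [← dissect_expand_mul (by norm_num)]
    refine congrArg (dissect 0) ?_; simp only [hF, E₅, map_pow, map_mul, expand_X]
    linear_combination X ^ 7 * expand5 (expand5 euler) ^ 7 * euler ^ 8 * hII 4
  have t1 : dissect 0 (F ^ (19 - 18) * euler ^ 18 * I ^ 4) =
      E₅ * dissect 0 (X * euler ^ 14) := by
    rw [← dissect_expand_mul (by norm_num)]
    refine congrArg (dissect 0) ?_; simp only [hF, E₅]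
    linear_combination X * expand5 (expand5 euler) * euler ^ 14 * hII 4
  rw [t4] at s0
  rw [t3] at s6
  rw [t2] at s12
  rw [t1] at s18
  rw [q4, q3, q2, q1]
  refine ⟨?_, ?_, ?_, ?_⟩
  · apply mul_left_cancel₀ (mul_ne_zero (pow_ne_zero 4 hE0)
      (mul_ne_zero (pow_ne_zero 3 hX) (pow_ne_zero 19 hE5)))
    linear_combination s0 - (78125 * X ^ 7 * E₅ ^ 39) * hII 4
  · apply mul_left_cancel₀ (mul_ne_zero (pow_ne_zero 2 hX) (pow_ne_zero 13 hE5))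
    linear_combination euler ^ 14 * s6
  · apply mul_left_cancel₀ (mul_ne_zero hX (pow_ne_zero 7 hE5))
    linear_combination euler ^ 8 * s12
  · apply mul_left_cancel₀ hE5
    linear_combination euler ^ 2 * s18

theorem iterate_dissect_eta_quotient {I : ℤ⟦X⟧} (hI : euler * I = 1) (m : ℕ) :
    ∃ f : ℤ⟦X⟧, (dissect 0)^[m + 2] (X ^ 4 * expand5 euler ^ 20 * I ^ 4) = 5 ^ (m + 5) * f := by
  obtain ⟨u4, u3, u2, u1⟩ := dissect_eta_quotients hI
  set b4 := X ^ 4 * expand5 euler ^ 20 * I ^ 4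
  set b3 := X ^ 3 * expand5 euler ^ 14 * euler ^ 2
  set b2 := X ^ 2 * expand5 euler ^ 8 * euler ^ 8
  set b1 := X * expand5 euler ^ 2 * euler ^ 14
  have hmul : ∀ (z : ℤ) (f : ℤ⟦X⟧), dissect 0 ((z : ℤ⟦X⟧) * f) = z * dissect 0 f := by
    intro z f
    rw [← zsmul_eq_mul, map_zsmul, zsmul_eq_mul]
  -- The b4 and b3 coordinates must carry an extra 5: the new b1 coordinate is 4 times the first
  -- minus the second, with no power of 5 from the matrix.
  suffices h : ∃ w x y z : ℤ, (dissect 0)^[m + 2] b4 = 5 ^ (m + 5) *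
      (((5 * w : ℤ) : ℤ⟦X⟧) * b4 + ((5 * x : ℤ) : ℤ⟦X⟧) * b3 + (y : ℤ⟦X⟧) * b2 + (z : ℤ⟦X⟧) * b1) by
    obtain ⟨w, x, y, z, h⟩ := h
    exact ⟨_, h⟩
  induction m with
  | zero =>
    -- Coordinates of U^2 b4, divided by 5^6, 5^6, 5^5, 5^5.
    refine ⟨390625, 62496, 13728, 96, ?_⟩
    have h1 : (dissect 0)^[0 + 2] b4 = dissect 0 (((78125 : ℤ) : ℤ⟦X⟧) * b4
      + ((12500 : ℤ) : ℤ⟦X⟧) * b3 + ((550 : ℤ) : ℤ⟦X⟧) * b2 + ((4 : ℤ) : ℤ⟦X⟧) * b1) := by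
      simp only [Function.iterate_succ, Function.comp, Function.iterate_zero, id, u4]
      push_cast; rfl
    rw [h1]
    simp only [map_add, hmul, u4, u3, u2, u1]
    push_cast
    ring
  | succ m ih =>
    obtain ⟨w, x, y, z, h⟩ := ih
    refine ⟨15625 * w, 2500 * w - 625 * z, 550 * w - 25 * y, 4 * w - x, ?_⟩
    rw [show m + 1 + 2 = (m + 2) + 1 by ring, Function.iterate_succ_apply', h,
      show (5 ^ (m + 5) : ℤ⟦X⟧) = ((5 ^ (m + 5) : ℤ) : ℤ⟦X⟧) by push_cast; rfl, hmul]
    simp only [map_add, hmul, u4, u3, u2, u1]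
    push_cast
    ring

end HeckeAction

end CoreSeries

namespace CoreSeries

open PowerSeries Finset

/-! ### Euler's expansion and the generating function of flush bead sets -/

section Pochhammer

/-- The finite product `∏ (1 - X ^ (p * i))` over `1 ≤ i ≤ N`. -/
noncomputable def qPochhammer (p N : ℕ) : ℤ⟦X⟧ := ∏ i ∈ range N, (1 - X ^ (p * (i + 1)))

/-- The inverse of `qPochhammer p N` for positive `p`. -/
noncomputable def qPochhammerInv (p N : ℕ) : ℤ⟦X⟧ := invOfUnit (qPochhammer p N) 1

theorem qPochhammer_succ (p N : ℕ) :
    qPochhammer p (N + 1) = qPochhammer p N * (1 - X ^ (p * (N + 1))) := by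
  rw [qPochhammer, prod_range_succ, qPochhammer]

theorem qPochhammer_mul_inv {p : ℕ} (hp : 0 < p) (N : ℕ) :
    qPochhammer p N * qPochhammerInv p N = 1 := by
  apply mul_invOfUnit
  rw [qPochhammer, map_prod]
  apply Finset.prod_eq_one
  intro i _
  have : p * (i + 1) ≠ 0 := by positivity
  simp [this]

theorem one_sub_X_pow_ne_zero {n : ℕ} (hn : n ≠ 0) : (1 - X ^ n : ℤ⟦X⟧) ≠ 0 := by
  intro h
  have := congrArg constantCoeff h
  simp [hn] at this

theorem qPochhammerInv_succ {p : ℕ} (hp : 0 < p) (N : ℕ) :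
    (1 - X ^ (p * (N + 1))) * qPochhammerInv p (N + 1) = qPochhammerInv p N := by
  have h0 := qPochhammer_mul_inv hp N
  have h1 := qPochhammer_mul_inv hp (N + 1)
  rw [qPochhammer_succ] at h1
  linear_combination qPochhammerInv p N * h1 -
    (1 - X ^ (p * (N + 1))) * qPochhammerInv p (N + 1) * h0

theorem X_pow_dvd_euler_sub (N : ℕ) : X ^ (N + 1) ∣ euler - qPochhammer 1 N := by
  have hstep : ∀ M, N ≤ M → (X ^ (N + 1) : ℤ⟦X⟧) ∣ qPochhammer 1 M - qPochhammer 1 N := by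
    intro M hM
    induction M, hM using Nat.le_induction with
    | base => simp
    | succ M hM ih =>
      rw [qPochhammer_succ]
      have : (X ^ (N + 1) : ℤ⟦X⟧) ∣ X ^ (1 * (M + 1)) := pow_dvd_pow _ (by omega)
      have h2 := dvd_sub ih (this.mul_left (qPochhammer 1 M))
      convert h2 using 1
      ring
  rw [X_pow_dvd_iff]
  intro n hn
  obtain ⟨s, hs⟩ := (coeff_prod_one_sub_X_pow_eventually_eq ℤ n).exists_forall_of_atTop
  obtain ⟨M, hM⟩ : ∃ M, s ⊆ range M := s.exists_nat_subset_range
  have h1 := hs (range (max M N)) (hM.trans (range_subset_range.2 (le_max_left _ _)))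
  have h2 := X_pow_dvd_iff.1 (hstep (max M N) (le_max_right _ _)) n hn
  rw [map_sub, ← h1, ← h2, map_sub]
  simp [qPochhammer]

theorem expand_qPochhammer (N : ℕ) : expand5 (qPochhammer 1 N) = qPochhammer 5 N := by
  rw [qPochhammer, qPochhammer, map_prod]
  refine prod_congr rfl fun i _ => ?_
  rw [map_sub, map_one, map_pow, expand_X, ← pow_mul, one_mul]

theorem X_pow_dvd_expand_euler_mul_inv_sub_one (N : ℕ) :
    X ^ (N + 1) ∣ expand5 euler * qPochhammerInv 5 N - 1 := by
  obtain ⟨f, hf⟩ := X_pow_dvd_euler_sub N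
  have h := congrArg expand5 hf
  rw [map_sub, expand_qPochhammer, map_mul, map_pow, expand_X] at h
  rw [← qPochhammer_mul_inv (show 0 < 5 by norm_num) N, ← sub_mul, h, ← pow_mul, mul_assoc]
  exact (pow_dvd_pow _ (by omega)).mul_right _

theorem X_pow_dvd_qPochhammerInv_sub {I : ℤ⟦X⟧} (hI : euler * I = 1) (N : ℕ) :
    X ^ (N + 1) ∣ qPochhammerInv 1 N - I := by
  have h : qPochhammerInv 1 N - I = (euler - qPochhammer 1 N) * (qPochhammerInv 1 N * I) := by
    linear_combination (-qPochhammerInv 1 N) * hI + I * qPochhammer_mul_inv one_pos N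
  rw [h]
  exact (X_pow_dvd_euler_sub N).mul_right _

/-- Euler's series `∑ q ^ (p * C(N, 2)) z ^ N / ((1 - q ^ p) ⋯ (1 - q ^ (p * N)))` for the product
`∏ (1 + q ^ (p * i) z)`, as a power series in `z` over the power series in `q`. -/
noncomputable def eulerProductSeries (p : ℕ) : ℤ⟦X⟧⟦X⟧ :=
  PowerSeries.mk fun N => X ^ (p * N.choose 2) * qPochhammerInv p N

/-- The equation f(z) = (1 + z) f(qz) determines each coefficient from the previous one, since 1 -
q^(n+1) is not a zero divisor. -/
theorem eq_of_eq_one_add_X_mul_rescale {f g : ℤ⟦X⟧⟦X⟧}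
    (hf : f = (1 + X) * rescale X f) (hg : g = (1 + X) * rescale X g)
    (h0 : coeff 0 f = coeff 0 g) : f = g := by
  have hrec : ∀ {f : ℤ⟦X⟧⟦X⟧}, f = (1 + X) * rescale X f → ∀ n,
      (1 - X ^ (n + 1)) * coeff (n + 1) f = X ^ n * coeff n f := by
    intro f hf n
    have h := congrArg (coeff (n + 1)) hf
    rw [add_mul, one_mul, map_add, coeff_succ_X_mul, coeff_rescale, coeff_rescale] at h
    linear_combination h
  ext1 n
  induction n with
  | zero => exact h0
  | succ n ih =>
    apply mul_left_cancel₀ (one_sub_X_pow_ne_zero (Nat.succ_ne_zero n))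
    rw [hrec hf, hrec hg, ih]

theorem eulerProductSeries_functional {p : ℕ} (hp : 0 < p) :
    eulerProductSeries p = (1 + X) * rescale (X ^ p) (eulerProductSeries p) := by
  ext1 n
  rcases n with _ | n
  · rw [add_mul, one_mul, map_add, coeff_zero_X_mul, coeff_rescale]
    simp
  · rw [add_mul, one_mul, map_add, coeff_succ_X_mul, coeff_rescale, coeff_rescale]
    simp only [eulerProductSeries, coeff_mk]
    rw [← qPochhammerInv_succ hp n, Nat.choose_succ_succ' n 1, Nat.choose_one_right,
      mul_add p, pow_add]
    ring

theorem coeff_zero_eulerProductSeries (p : ℕ) (hp : 0 < p) : coeff 0 (eulerProductSeries p) = 1 := by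
  rw [eulerProductSeries, coeff_mk]
  have := qPochhammer_mul_inv hp 0
  simpa [qPochhammer] using this

/-- This splits ∏ (1 + q^i z) by i mod 5. Under z ↦ qz the five factors shift cyclically, and the
wrap-around from r = 4 to r = 5 is the functional equation for p = 5. -/
theorem eulerProductSeries_one_eq_prod :
    eulerProductSeries 1 = ∏ r : Fin 5, rescale (X ^ (r : ℕ)) (eulerProductSeries 5) := by
  apply eq_of_eq_one_add_X_mul_rescale
  · simpa using eulerProductSeries_functional one_pos
  · have h := eulerProductSeries_functional (show 0 < 5 by norm_num)
    have hr : ∀ r : ℕ, rescale X (rescale (X ^ r) (eulerProductSeries 5)) =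
        rescale (X ^ (r + 1)) (eulerProductSeries 5) := fun r => by
      rw [rescale_rescale, ← pow_succ]
    have h0 : rescale (X ^ 0) (eulerProductSeries 5) = eulerProductSeries 5 := by simp
    rw [map_prod]
    simp only [hr, Fin.prod_univ_five]
    change rescale (X ^ 0) _ * rescale (X ^ 1) _ * rescale (X ^ 2) _ * rescale (X ^ 3) _ *
      rescale (X ^ 4) _ = (1 + X) * (rescale (X ^ 1) _ * rescale (X ^ 2) _ * rescale (X ^ 3) _ *
      rescale (X ^ 4) _ * rescale (X ^ 5) _)
    rw [h0]
    linear_combination (rescale (X ^ 1) (eulerProductSeries 5) *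
      rescale (X ^ 2) (eulerProductSeries 5) * rescale (X ^ 3) (eulerProductSeries 5) *
      rescale (X ^ 4) (eulerProductSeries 5)) * h
  · rw [coeff_zero_eulerProductSeries 1 one_pos, coeff_zero_eq_constantCoeff_apply, map_prod]
    symm
    apply Finset.prod_eq_one
    intro r _
    rw [← coeff_zero_eq_constantCoeff_apply, coeff_rescale,
      coeff_zero_eulerProductSeries 5 (by norm_num)]
    simp

/-- The exponent attached to `v` in Euler's identity: the sum of the entries of the bead set with
`v r` beads pushed down on each runner `r`. -/
def beadSum (v : Fin 5 → ℕ) : ℕ := ∑ r, (5 * (v r).choose 2 + r * v r)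

theorem coeff_prod_univ {ι R : Type*} [Fintype ι] [DecidableEq ι] [CommSemiring R]
    (f : ι → R⟦X⟧) (n : ℕ) :
    coeff n (∏ i, f i) = ∑ v ∈ piAntidiag univ n, ∏ i, coeff (v i) (f i) := by
  rw [coeff_prod]
  refine Finset.sum_bij (fun l _ => ⇑l) ?_ ?_ ?_ ?_
  · intro l hl
    rw [mem_finsuppAntidiag] at hl
    simp [mem_piAntidiag, hl.1]
  · exact fun l _ l' _ h => DFunLike.coe_injective h
  · intro v hv
    refine ⟨Finsupp.equivFunOnFinite.symm v, ?_, rfl⟩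
    rw [mem_piAntidiag] at hv
    simpa [mem_finsuppAntidiag] using hv.1
  · intro l _
    rfl

theorem X_pow_mul_qPochhammerInv_eq_sum (N : ℕ) :
    X ^ N.choose 2 * qPochhammerInv 1 N =
      ∑ v ∈ piAntidiag (univ : Finset (Fin 5)) N,
        X ^ beadSum v * ∏ r, qPochhammerInv 5 (v r) := by
  have h := congrArg (coeff N) eulerProductSeries_one_eq_prod
  rw [eulerProductSeries, coeff_mk, one_mul, coeff_prod_univ] at h
  rw [h]
  refine sum_congr rfl fun v _ => ?_
  rw [beadSum, ← prod_pow_eq_pow_sum, ← prod_mul_distrib]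
  refine prod_congr rfl fun r _ => ?_
  rw [coeff_rescale, eulerProductSeries, coeff_mk]
  ring

theorem dvd_prod_sub_one {ι A : Type*} [CommRing A] (s : Finset ι) {d : A} {f : ι → A}
    (h : ∀ i ∈ s, d ∣ f i - 1) : d ∣ ∏ i ∈ s, f i - 1 := by
  classical
  induction s using Finset.induction_on with
  | empty => simp
  | insert a s ha ih =>
    rw [prod_insert ha]
    have h1 := h a (mem_insert_self a s)
    have h2 := ih fun i hi => h i (mem_insert_of_mem hi)
    convert dvd_add (h1.mul_right (∏ i ∈ s, f i)) h2 using 1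
    ring

theorem two_mul_choose_two (n : ℕ) : 2 * (n.choose 2 : ℤ) = n * (n - 1) := by
  rcases n with _ | n
  · simp
  · have h := Nat.triangle_succ n
    have h1 : 2 * (n + 1).choose 2 = (n + 1) * n := by
      rw [Nat.choose_two_right, Nat.add_sub_cancel]
      exact Nat.mul_div_cancel' (by rw [mul_comm]; exact (Nat.even_mul_succ_self n).two_dvd)
    push_cast
    zify at h1
    linarith

/-- With c_r = v_r - M, which sum to 0, twice the excess of `beadSum v` over C(5M, 2) is ∑ (5 c_r^2
+ 2(r - 2) c_r). Every summand is nonnegative and at least -2 c_r - 1; integrality then gives excess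
≥ -c_r. -/
theorem choose_two_add_le_beadSum {M : ℕ} {v : Fin 5 → ℕ} (hv : ∑ r, v r = 5 * M) (r : Fin 5) :
    (5 * M).choose 2 + M ≤ beadSum v + v r := by
  have hterm : ∀ (c : ℤ) (s : ℤ), |s| ≤ 2 → 0 ≤ 5 * c ^ 2 + 2 * s * c ∧
      -2 * c - 1 ≤ 5 * c ^ 2 + 2 * s * c := by
    intro c s hs
    obtain ⟨h1, h2⟩ := abs_le.1 hs
    rcases lt_trichotomy c 0 with hc | hc | hc
    · constructor <;> nlinarith
    · subst hc; simp
    · constructor <;> nlinarith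
  have e0 := two_mul_choose_two (5 * M)
  have e := fun r => two_mul_choose_two (v r)
  have h0 := hterm (v 0 - M) (-2) (by norm_num)
  have h1 := hterm (v 1 - M) (-1) (by norm_num)
  have h2 := hterm (v 2 - M) 0 (by norm_num)
  have h3 := hterm (v 3 - M) 1 (by norm_num)
  have h4 := hterm (v 4 - M) 2 (by norm_num)
  have hB : (2 * beadSum v : ℤ) = ∑ r : Fin 5, (5 * ((v r : ℤ) * (v r - 1)) + 2 * (r : ℕ) * v r) := by
    rw [beadSum]
    push_cast
    rw [mul_sum]
    refine sum_congr rfl fun r _ => ?_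
    rw [← e r]; ring
  rw [Fin.sum_univ_five] at hB hv
  have hv' : (v 0 + v 1 + v 2 + v 3 + v 4 : ℤ) = 5 * M := by exact_mod_cast hv
  have k3 : ((3 : Fin 5) : ℕ) = 3 := rfl
  have k4 : ((4 : Fin 5) : ℕ) = 4 := rfl
  simp only [Fin.val_zero, Fin.val_one, Fin.val_two, k3, k4] at hB
  push_cast at hB e0
  have key : (2 * beadSum v - 2 * (5 * M).choose 2 : ℤ) =
      (5 * (v 0 - M : ℤ) ^ 2 + 2 * (-2) * (v 0 - M)) + (5 * (v 1 - M : ℤ) ^ 2 + 2 * (-1) * (v 1 - M)) +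
      (5 * (v 2 - M : ℤ) ^ 2 + 2 * 0 * (v 2 - M)) + (5 * (v 3 - M : ℤ) ^ 2 + 2 * 1 * (v 3 - M)) +
      (5 * (v 4 - M : ℤ) ^ 2 + 2 * 2 * (v 4 - M)) := by
    rw [hB, e0]
    linear_combination (10 * M - 1 : ℤ) * hv'
  zify
  fin_cases r <;> simp <;> linarith

/-- The identity for z^(5M) is multiplied by E(q^5)^5. Each factor E(q^5) / ∏_{i ≤ v_r} (1 - q^(5i))
is 1 up to degree v_r, and a small v_r forces a large `beadSum v`. So up to the relevant degree each
v contributes only the monomial q^(beadSum v). -/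
theorem coeff_core_product {I : ℤ⟦X⟧} (hI : euler * I = 1) {n M : ℕ} (hn : n < M) :
    coeff n (expand5 euler ^ 5 * I) =
      (#{v ∈ piAntidiag (univ : Finset (Fin 5)) (5 * M) |
        beadSum v = (5 * M).choose 2 + n} : ℤ) := by
  have h1 : coeff n (expand5 euler ^ 5 * I) =
      coeff (n + (5 * M).choose 2) (X ^ (5 * M).choose 2 *
        (expand5 euler ^ 5 * qPochhammerInv 1 (5 * M))) := by
    rw [coeff_X_pow_mul, ← sub_eq_zero, ← map_sub, ← mul_sub, ← neg_sub, mul_neg, map_neg,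
      neg_eq_zero]
    exact X_pow_dvd_iff.1 ((X_pow_dvd_qPochhammerInv_sub hI (5 * M)).mul_left _) n (by omega)
  rw [h1, mul_left_comm, X_pow_mul_qPochhammerInv_eq_sum, mul_sum, map_sum, card_filter]
  push_cast
  refine sum_congr rfl fun v hv => ?_
  rw [mem_piAntidiag] at hv
  have hle := fun r => choose_two_add_le_beadSum hv.1 r
  have h2 : expand5 euler ^ 5 * (X ^ beadSum v * ∏ r, qPochhammerInv 5 (v r)) =
      X ^ beadSum v * ∏ r, (expand5 euler * qPochhammerInv 5 (v r)) := by
    rw [prod_mul_distrib, prod_const, card_univ, Fintype.card_fin]; ring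
  rw [h2, coeff_X_pow_mul']
  by_cases hb : beadSum v ≤ n + (5 * M).choose 2
  · rw [if_pos hb]
    have h3 : X ^ (n + (5 * M).choose 2 - beadSum v + 1) ∣
        ∏ r, (expand5 euler * qPochhammerInv 5 (v r)) - 1 := by
      apply dvd_prod_sub_one
      intro r _
      refine (pow_dvd_pow _ ?_).trans (X_pow_dvd_expand_euler_mul_inv_sub_one (v r))
      have := hle r
      omega
    have h4 := X_pow_dvd_iff.1 h3 _ (Nat.lt_succ_self _)
    rw [map_sub, sub_eq_zero] at h4
    rw [h4, coeff_one]
    congr 1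
    simp only [eq_iff_iff]
    omega
  · rw [if_neg hb, if_neg (by omega)]

end Pochhammer

end CoreSeries

namespace CoreSeries

open PowerSeries Finset

/-! ### Bead sets, the abacus and 5-cores -/

section Beads

theorem rowLen_eq_zero {μ : YoungDiagram} {N i : ℕ} (h : μ.colLen 0 ≤ N) (hi : N ≤ i) :
    μ.rowLen i = 0 := by
  by_contra h0
  have h1 : (i, 0) ∈ μ := YoungDiagram.mem_iff_lt_rowLen.2 (Nat.pos_of_ne_zero h0)
  have := YoungDiagram.mem_iff_lt_colLen.1 h1
  omega

theorem colLen_le_card (μ : YoungDiagram) (j : ℕ) : μ.colLen j ≤ μ.card := by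
  rw [YoungDiagram.colLen_eq_card]
  exact card_le_card (filter_subset _ _)

theorem card_eq_sum_rowLen {μ : YoungDiagram} {N : ℕ} (h : μ.colLen 0 ≤ N) :
    μ.card = ∑ i ∈ range N, μ.rowLen i := by
  rw [YoungDiagram.card, card_eq_sum_card_fiberwise (f := Prod.fst) (t := range N)]
  · refine sum_congr rfl fun i _ => ?_
    rw [YoungDiagram.rowLen_eq_card]; rfl
  · rintro ⟨i, j⟩ hc
    simp only [coe_range, Set.mem_Iio]
    have h1 : (i, j) ∈ μ := hc
    have h2 := YoungDiagram.mem_iff_lt_colLen.1 h1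
    have h3 := μ.colLen_anti 0 j (Nat.zero_le _)
    omega

theorem hookNumber_add {μ : YoungDiagram} {i j : ℕ} (h : (i, j) ∈ μ) :
    hookNumber μ (i, j) + i + j + 1 = μ.rowLen i + μ.colLen j := by
  have h1 := YoungDiagram.mem_iff_lt_rowLen.1 h
  have h2 := YoungDiagram.mem_iff_lt_colLen.1 h
  have hset : (μ.cells.filter fun d => (d.1 = i ∧ j ≤ d.2) ∨ (d.2 = j ∧ i ≤ d.1)) =
      ({i} ×ˢ Ico j (μ.rowLen i)) ∪ (Ico (i + 1) (μ.colLen j) ×ˢ {j}) := by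
    ext ⟨a, b⟩
    simp only [mem_filter, mem_union, mem_product, mem_singleton, mem_Ico, YoungDiagram.mem_cells]
    constructor
    · rintro ⟨hm, ⟨rfl, hb⟩ | ⟨rfl, ha⟩⟩
      · exact Or.inl ⟨rfl, hb, YoungDiagram.mem_iff_lt_rowLen.1 hm⟩
      · rcases ha.eq_or_lt with rfl | ha
        · exact Or.inl ⟨rfl, le_rfl, h1⟩
        · exact Or.inr ⟨⟨ha, YoungDiagram.mem_iff_lt_colLen.1 hm⟩, rfl⟩
    · rintro (⟨rfl, hb, hb'⟩ | ⟨⟨ha, ha'⟩, rfl⟩)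
      · exact ⟨YoungDiagram.mem_iff_lt_rowLen.2 hb', Or.inl ⟨rfl, hb⟩⟩
      · exact ⟨YoungDiagram.mem_iff_lt_colLen.2 ha', Or.inr ⟨rfl, by omega⟩⟩
  rw [hookNumber, hset, card_union_of_disjoint]
  · simp only [card_product, card_singleton, Nat.card_Ico]
    omega
  · rw [disjoint_left]
    rintro ⟨a, b⟩ h3 h4
    simp only [mem_product, mem_singleton, mem_Ico] at h3 h4
    omega

/-- The first-column hook lengths of `μ`, padded to `N` rows. -/
def beadSet (N : ℕ) (μ : YoungDiagram) : Finset ℕ :=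
  univ.image fun i : Fin N => μ.rowLen (N - 1 - i) + i

theorem strictMono_bead (N : ℕ) (μ : YoungDiagram) :
    StrictMono fun i : Fin N => μ.rowLen (N - 1 - i) + i := by
  intro i k h
  have h1 := μ.rowLen_anti (N - 1 - k) (N - 1 - i) (by have : (i : ℕ) < k := h; omega)
  have : (i : ℕ) < k := h
  simp only
  omega

theorem card_beadSet (N : ℕ) (μ : YoungDiagram) : #(beadSet N μ) = N := by
  rw [beadSet, card_image_of_injective _ (strictMono_bead N μ).injective, card_univ,
    Fintype.card_fin]

theorem mem_beadSet {N : ℕ} {μ : YoungDiagram} {x : ℕ} :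
    x ∈ beadSet N μ ↔ ∃ i < N, μ.rowLen i + (N - 1 - i) = x := by
  simp only [beadSet, mem_image, mem_univ, true_and]
  constructor
  · rintro ⟨i, rfl⟩
    exact ⟨N - 1 - i, by omega, by congr 1; omega⟩
  · rintro ⟨i, hi, rfl⟩
    refine ⟨⟨N - 1 - i, by omega⟩, ?_⟩
    simp only
    congr 2
    omega

theorem sum_range_id_eq_choose (N : ℕ) : ∑ i ∈ range N, i = N.choose 2 := by
  rw [sum_range_id, Nat.choose_two_right]

theorem sum_beadSet {N : ℕ} {μ : YoungDiagram} (h : μ.colLen 0 ≤ N) :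
    ∑ x ∈ beadSet N μ, x = N.choose 2 + μ.card := by
  rw [beadSet, sum_image (strictMono_bead N μ).injective.injOn, sum_add_distrib,
    Fin.sum_univ_eq_sum_range (fun i => μ.rowLen (N - 1 - i)), sum_range_reflect μ.rowLen,
    Fin.sum_univ_eq_sum_range (fun i => i), sum_range_id_eq_choose, card_eq_sum_rowLen h, add_comm]

/-- A finite set has only one increasing enumeration, so the beads determine the rows. -/
theorem beadSet_injOn (N : ℕ) : Set.InjOn (beadSet N) {μ | μ.colLen 0 ≤ N} := by
  intro μ hμ ν hν h
  have h1 := orderEmbOfFin_unique (card_beadSet N ν)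
    (f := fun i : Fin N => μ.rowLen (N - 1 - i) + i)
    (fun i => by rw [← h]; exact mem_image_of_mem _ (mem_univ i)) (strictMono_bead N μ)
  have h2 := orderEmbOfFin_unique (card_beadSet N ν)
    (f := fun i : Fin N => ν.rowLen (N - 1 - i) + i)
    (fun i => mem_image_of_mem _ (mem_univ i)) (strictMono_bead N ν)
  have h3 : ∀ i, μ.rowLen i = ν.rowLen i := by
    intro i
    by_cases hi : i < N
    · have h4 := congrFun (h1.trans h2.symm) ⟨N - 1 - i, by omega⟩
      simp only [Nat.add_right_cancel_iff] at h4
      rwa [show N - 1 - (N - 1 - i) = i by omega] at h4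
    · rw [rowLen_eq_zero hμ (by omega), rowLen_eq_zero hν (by omega)]
  ext ⟨i, j⟩
  rw [YoungDiagram.mem_cells, YoungDiagram.mem_cells, YoungDiagram.mem_iff_lt_rowLen,
    YoungDiagram.mem_iff_lt_rowLen, h3]

theorem exists_rowLen_eq {w : ℕ → ℕ} (hw : Antitone w) {N : ℕ} (hN : ∀ i, N ≤ i → w i = 0) :
    ∃ μ : YoungDiagram, (∀ i, μ.rowLen i = w i) ∧ μ.colLen 0 ≤ N := by
  let μ : YoungDiagram :=
    { cells := (range N ×ˢ range (w 0)).filter fun c => c.2 < w c.1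
      isLowerSet := by
        rintro ⟨i, j⟩ ⟨i', j'⟩ hle h
        simp only [coe_filter, mem_product, mem_range, Set.mem_ofPred_eq] at h ⊢
        obtain ⟨h1, h2⟩ := Prod.mk_le_mk.1 hle
        have := hw h1
        omega }
  have hmem : ∀ i j, (i, j) ∈ μ ↔ j < w i := by
    intro i j
    rw [← YoungDiagram.mem_cells]
    simp only [μ, mem_filter, mem_product, mem_range]
    refine ⟨fun h => h.2, fun h => ⟨⟨?_, ?_⟩, h⟩⟩
    · by_contra hi
      rw [hN i (by omega)] at h
      omega
    · exact h.trans_le (hw (Nat.zero_le _))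
  refine ⟨μ, fun i => ?_, ?_⟩
  · apply eq_of_forall_lt_iff
    intro j
    rw [← YoungDiagram.mem_iff_lt_rowLen, hmem]
  · by_contra h
    have h1 := (hmem N 0).1 (YoungDiagram.mem_iff_lt_colLen.2 (not_le.1 h))
    rw [hN N le_rfl] at h1
    omega

theorem exists_beadSet_eq (s : Finset ℕ) :
    ∃ μ : YoungDiagram, μ.colLen 0 ≤ #s ∧ beadSet #s μ = s := by
  set N := #s with hN
  set f := s.orderEmbOfFin hN.symm with hf
  have hadd : ∀ d (i : ℕ) (h : i + d < N), f ⟨i, by omega⟩ + d ≤ f ⟨i + d, h⟩ := by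
    intro d
    induction d with
    | zero => intro i h; simp
    | succ d ih =>
      intro i h
      have h1 := ih i (by omega)
      have h2 : f ⟨i + d, by omega⟩ < f ⟨i + (d + 1), h⟩ := f.strictMono (by
        rw [Fin.mk_lt_mk]; omega)
      omega
  -- A row length is the bead minus the number of smaller beads, that is, the number of gaps below
  -- it.
  let w : ℕ → ℕ := fun j => if h : j < N then f ⟨N - 1 - j, by omega⟩ - (N - 1 - j) else 0
  have hw : Antitone w := by
    intro i k hik
    simp only [w]
    by_cases hk : k < N
    · rw [dif_pos hk, dif_pos (by omega)]
      have h1 := hadd (k - i) (N - 1 - k) (by omega)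
      have h2 : (⟨N - 1 - k + (k - i), by omega⟩ : Fin N) = ⟨N - 1 - i, by omega⟩ :=
        Fin.ext (by simp only; omega)
      rw [h2] at h1
      omega
    · rw [dif_neg hk]; exact Nat.zero_le _
  obtain ⟨μ, hμ, hcol⟩ := exists_rowLen_eq hw (N := N) fun i hi => dif_neg (by omega)
  refine ⟨μ, hcol, ?_⟩
  apply eq_of_subset_of_card_le
  · intro x hx
    rw [mem_beadSet] at hx
    obtain ⟨i, hi, rfl⟩ := hx
    rw [hμ]
    simp only [w]
    rw [dif_pos hi]
    have h1 := hadd (N - 1 - i) 0 (by omega)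
    have h2 : (⟨0 + (N - 1 - i), by omega⟩ : Fin N) = ⟨N - 1 - i, by omega⟩ :=
      Fin.ext (by simp only; omega)
    rw [h2] at h1
    rw [Nat.sub_add_cancel (by omega)]
    exact orderEmbOfFin_mem s hN.symm _
  · rw [card_beadSet]

/-- Hook numbers are differences bead minus gap: the bead of row i minus the hook at (i, j) is j + N
- colLen j, which is never a bead. -/
theorem isTCore_iff_beadSet {t N : ℕ} {μ : YoungDiagram} (ht : 0 < t) (h : μ.colLen 0 ≤ N) :
    IsTCore t μ ↔ ∀ x, x + t ∈ beadSet N μ → x ∈ beadSet N μ := by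
  constructor
  · intro hcore y hx
    by_contra hy
    rw [mem_beadSet] at hx
    obtain ⟨i, hi, hix⟩ := hx
    -- The first row whose bead lies below the gap y, or N if there is none, is the length of the
    -- column j = y + k - N; the hook at (i, j) is then exactly t.
    have hex : ∃ k, N ≤ k ∨ μ.rowLen k + (N - 1 - k) < y := ⟨N, Or.inl le_rfl⟩
    classical
    obtain ⟨k, hk⟩ : ∃ k, k = Nat.find hex := ⟨_, rfl⟩
    have hspec := Nat.find_spec hex
    have hmin : ∀ l < k, l < N ∧ y < μ.rowLen l + (N - 1 - l) := by
      intro l hl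
      rw [hk] at hl
      have := Nat.find_min hex hl
      push Not at this
      refine ⟨this.1, lt_of_le_of_ne this.2 ?_⟩
      rintro rfl
      exact hy (mem_beadSet.2 ⟨l, this.1, rfl⟩)
    rw [← hk] at hspec
    have hkN : k ≤ N := by
      rw [hk]; exact Nat.find_min' hex (Or.inl le_rfl)
    have hik : i < k := by
      by_contra hik
      have := μ.rowLen_anti k i (by omega)
      omega
    have hkj : N ≤ y + k := by
      rcases hspec with h1 | h1 <;> omega
    obtain ⟨j, hj⟩ : ∃ j, j + N = y + k := ⟨y + k - N, by omega⟩
    have hcol : μ.colLen j = k := by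
      apply le_antisymm
      · by_contra hlt
        have hm := YoungDiagram.mem_iff_lt_rowLen.1
          (YoungDiagram.mem_iff_lt_colLen.2 (not_le.1 hlt))
        by_cases hkN' : k = N
        · rw [rowLen_eq_zero h (by omega)] at hm; omega
        · omega
      · have h1 := hmin (k - 1) (by omega)
        have h2 : (k - 1, j) ∈ μ := YoungDiagram.mem_iff_lt_rowLen.2 (by omega)
        have := YoungDiagram.mem_iff_lt_colLen.1 h2
        omega
    have hmem : (i, j) ∈ μ := YoungDiagram.mem_iff_lt_colLen.2 (by omega)
    have hhook := hookNumber_add hmem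
    refine hcore (i, j) hmem ?_
    have : hookNumber μ (i, j) = t := by omega
    rw [this]
  · rintro hcl ⟨i, j⟩ hmem ⟨m, hm⟩
    have hmem' : (i, j) ∈ μ := hmem
    have hhook := hookNumber_add hmem'
    have hi := YoungDiagram.mem_iff_lt_colLen.1 hmem'
    have hcolN : μ.colLen j ≤ N := (μ.colLen_anti 0 j (Nat.zero_le _)).trans h
    have hdown : ∀ m y, y + t * m ∈ beadSet N μ → y ∈ beadSet N μ := by
      intro m
      induction m with
      | zero => intro y hy; simpa using hy
      | succ m ih =>
        intro y hy
        exact ih y (hcl _ (by rwa [mul_add, mul_one, ← add_assoc] at hy))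
    -- Sliding the bead of row i down by its hook number t * m would land on a gap.
    have hy : j + (N - μ.colLen j) ∈ beadSet N μ := by
      apply hdown m
      rw [mem_beadSet]
      exact ⟨i, by omega, by rw [← hm]; omega⟩
    rw [mem_beadSet] at hy
    obtain ⟨k, hk, hky⟩ := hy
    by_cases hkc : k < μ.colLen j
    · have := YoungDiagram.mem_iff_lt_rowLen.1 (YoungDiagram.mem_iff_lt_colLen.2 hkc)
      omega
    · have : ¬ j < μ.rowLen k := fun h1 =>
        hkc (YoungDiagram.mem_iff_lt_colLen.1 (YoungDiagram.mem_iff_lt_rowLen.2 h1))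
      omega

/-- The bead set with `v r` beads pushed down on each runner `r` of the abacus. -/
def flushBeads (v : Fin 5 → ℕ) : Finset ℕ :=
  ((univ : Finset (Fin 5)).sigma fun r => range (v r)).map
    ⟨fun x => 5 * x.2 + x.1, by
      rintro ⟨r, m⟩ ⟨r', m'⟩ h
      simp only at h
      have h1 : m = m' := by omega
      have h2 : r = r' := Fin.ext (by omega)
      rw [h1, h2]⟩

theorem mem_flushBeads {v : Fin 5 → ℕ} {m : ℕ} {r : Fin 5} :
    5 * m + r ∈ flushBeads v ↔ m < v r := by
  simp only [flushBeads, mem_map, mem_sigma, mem_univ, mem_range,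
    true_and]
  constructor
  · rintro ⟨⟨r', m'⟩, h1, h2⟩
    change 5 * m' + (r' : ℕ) = 5 * m + r at h2
    have h3 : m' = m := by omega
    have h4 : r' = r := Fin.ext (by omega)
    rwa [h3, h4] at h1
  · intro h
    exact ⟨⟨r, m⟩, h, rfl⟩

theorem card_flushBeads (v : Fin 5 → ℕ) : #(flushBeads v) = ∑ r, v r := by
  simp [flushBeads]

theorem sum_flushBeads (v : Fin 5 → ℕ) : ∑ x ∈ flushBeads v, x = beadSum v := by
  rw [flushBeads, sum_map, sum_sigma, beadSum]
  refine sum_congr rfl fun r _ => ?_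
  change ∑ m ∈ range (v r), (5 * m + (r : ℕ)) = _
  rw [sum_add_distrib, ← mul_sum, sum_range_id_eq_choose, sum_const, card_range, smul_eq_mul,
    mul_comm (v r)]

theorem flushBeads_injective : Function.Injective flushBeads := by
  intro v v' h
  funext r
  apply eq_of_forall_lt_iff
  intro m
  rw [← mem_flushBeads, ← mem_flushBeads, h]

theorem exists_eq_add_fin (x : ℕ) : ∃ (m : ℕ) (r : Fin 5), x = 5 * m + r :=
  ⟨x / 5, ⟨x % 5, Nat.mod_lt _ (by norm_num)⟩, by simp only; omega⟩

theorem exists_flushBeads_iff (s : Finset ℕ) :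
    (∃ v, flushBeads v = s) ↔ ∀ x, x + 5 ∈ s → x ∈ s := by
  constructor
  · rintro ⟨v, rfl⟩ x hx
    obtain ⟨m, r, rfl⟩ := exists_eq_add_fin x
    rw [show 5 * m + (r : ℕ) + 5 = 5 * (m + 1) + r by ring, mem_flushBeads] at hx
    rw [mem_flushBeads]
    omega
  · intro hs
    have hex : ∀ r : Fin 5, ∃ m, 5 * m + (r : ℕ) ∉ s := by
      intro r
      obtain ⟨B, hB⟩ := s.exists_nat_subset_range
      refine ⟨B, fun h => ?_⟩
      have := mem_range.1 (hB h)
      omega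
    refine ⟨fun r => Nat.find (hex r), ?_⟩
    ext x
    obtain ⟨m, r, rfl⟩ := exists_eq_add_fin x
    rw [mem_flushBeads]
    constructor
    · intro h
      exact not_not.1 (Nat.find_min (hex r) h)
    · intro h
      by_contra hle
      have hdown : ∀ d y, y + 5 * d ∈ s → y ∈ s := by
        intro d
        induction d with
        | zero => intro y hy; simpa using hy
        | succ d ih =>
          intro y hy
          exact ih y (hs _ (by rwa [mul_add, mul_one, ← add_assoc] at hy))
      refine Nat.find_spec (hex r) (hdown (m - Nat.find (hex r)) _ ?_)
      convert h using 1
      omega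

/-- Both sides count the N-element sets closed under x + 5 ↦ x with sum C(N, 2) + n; N ≥ n leaves
room for every row. -/
theorem ncard_cores {n N : ℕ} (hn : n ≤ N) :
    {μ : YoungDiagram | IsTCore 5 μ ∧ μ.card = n}.ncard =
      #{v ∈ piAntidiag (univ : Finset (Fin 5)) N | beadSum v = N.choose 2 + n} := by
  let T : Set (Finset ℕ) :=
    {s | #s = N ∧ (∀ x, x + 5 ∈ s → x ∈ s) ∧ ∑ x ∈ s, x = N.choose 2 + n}
  have h1 : Set.BijOn (beadSet N) {μ : YoungDiagram | IsTCore 5 μ ∧ μ.card = n} T := by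
    have hsmall : ∀ μ : YoungDiagram, μ.card = n → μ.colLen 0 ≤ N := fun μ hμ =>
      (colLen_le_card μ 0).trans (hμ.le.trans hn)
    refine ⟨?_, (beadSet_injOn N).mono fun μ hμ => hsmall μ hμ.2, ?_⟩
    · rintro μ ⟨hcore, hμ⟩
      have h := hsmall μ hμ
      exact ⟨card_beadSet N μ, (isTCore_iff_beadSet (by norm_num) h).1 hcore,
        by rw [sum_beadSet h, hμ]⟩
    · rintro s ⟨hs, hcl, hsum⟩
      obtain ⟨μ, hcol, hμ⟩ := exists_beadSet_eq s
      rw [hs] at hcol hμ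
      refine ⟨μ, ⟨(isTCore_iff_beadSet (by norm_num) hcol).2 (by rwa [hμ]), ?_⟩, hμ⟩
      have := sum_beadSet hcol
      rw [hμ, hsum] at this
      omega
  have h2 : Set.BijOn flushBeads
      {v | v ∈ ({v ∈ piAntidiag (univ : Finset (Fin 5)) N | beadSum v = N.choose 2 + n} :
        Finset (Fin 5 → ℕ))} T := by
    refine ⟨?_, flushBeads_injective.injOn, ?_⟩
    · intro v hv
      simp only [Set.mem_ofPred_eq, mem_filter, mem_piAntidiag] at hv
      exact ⟨by rw [card_flushBeads, hv.1.1], (exists_flushBeads_iff _).1 ⟨v, rfl⟩,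
        by rw [sum_flushBeads, hv.2]⟩
    · rintro s ⟨hs, hcl, hsum⟩
      obtain ⟨v, rfl⟩ := (exists_flushBeads_iff s).2 hcl
      refine ⟨v, ?_, rfl⟩
      rw [card_flushBeads] at hs
      rw [sum_flushBeads] at hsum
      simp [mem_piAntidiag, hs, hsum]
  rw [h1.ncard_eq, ← h2.ncard_eq]
  exact Set.ncard_coe_finset _

theorem coeff_core_series {I : ℤ⟦X⟧} (hI : euler * I = 1) (n : ℕ) :
    coeff n (expand5 euler ^ 5 * I) =
      ({μ : YoungDiagram | IsTCore 5 μ ∧ μ.card = n}.ncard : ℤ) := by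
  rw [coeff_core_product hI (Nat.lt_succ_self n), ncard_cores (N := 5 * (n + 1)) (by omega)]

theorem tupleCoreCount_eq_sum (t k n : ℕ) :
    tupleCoreCount t k n = ∑ v ∈ piAntidiag (univ : Finset (Fin k)) n,
      ∏ i, {μ : YoungDiagram | IsTCore t μ ∧ μ.card = v i}.ncard := by
  classical
  have hfin : ∀ m, {μ : YoungDiagram | IsTCore t μ ∧ μ.card = m}.Finite := by
    intro m
    refine ((coreTuples_finite t 1 m).image fun Λ => Λ 0).subset ?_
    rintro μ ⟨hμ, hm⟩
    exact ⟨fun _ => μ, ⟨by simp [hm], fun _ => hμ⟩, rfl⟩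
  rw [tupleCoreCount, Set.ncard_eq_toFinset_card _ (coreTuples_finite t k n),
    card_eq_sum_card_fiberwise (f := fun Λ i => (Λ i).card) (t := piAntidiag univ n)]
  · refine sum_congr rfl fun v hv => ?_
    rw [mem_piAntidiag] at hv
    simp_rw [fun i => Set.ncard_eq_toFinset_card _ (hfin (v i))]
    rw [← Fintype.card_piFinset]
    congr 1
    ext Λ
    simp only [mem_filter, Set.Finite.mem_toFinset, Fintype.mem_piFinset, coreTuples,
      Set.mem_ofPred_eq]
    constructor
    · rintro ⟨⟨-, h2⟩, rfl⟩ i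
      exact ⟨h2 i, rfl⟩
    · intro h
      refine ⟨⟨?_, fun i => (h i).1⟩, funext fun i => (h i).2⟩
      rw [← hv.1]
      exact sum_congr rfl fun i _ => (h i).2
  · intro Λ hΛ
    have h := (coreTuples_finite t k n).mem_toFinset.1 hΛ
    simpa [mem_piAntidiag] using h.1

theorem tupleCoreCount_eq_coeff {I : ℤ⟦X⟧} (hI : euler * I = 1) (k n : ℕ) :
    (tupleCoreCount 5 k n : ℤ) = coeff n ((expand5 euler ^ 5 * I) ^ k) := by
  have h := coeff_prod_univ (fun _ : Fin k => expand5 euler ^ 5 * I) n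
  rw [prod_const, card_univ, Fintype.card_fin] at h
  rw [h, tupleCoreCount_eq_sum]
  push_cast
  refine sum_congr rfl fun v _ => prod_congr rfl fun i _ => ?_
  rw [coeff_core_series hI]

theorem coeff_iterate_dissect (m n : ℕ) (f : ℤ⟦X⟧) :
    coeff n ((dissect 0)^[m] f) = coeff (5 ^ m * n) f := by
  induction m generalizing n with
  | zero => simp
  | succ m ih =>
    rw [Function.iterate_succ_apply', coeff_dissect, ih]
    congr 1
    ring_nf

end Beads

end CoreSeries

open PowerSeries CoreSeries in
theorem theorem1 (n α : ℕ) (hα : 1 ≤ α) :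
    tupleCoreCount 5 4 (5 ^ (α + 1) * n + 5 ^ (α + 1) - 4) ≡ 0 [MOD 5 ^ (α + 4)] := by
  obtain ⟨m, rfl⟩ : ∃ m, α = m + 1 := ⟨α - 1, by omega⟩
  obtain ⟨I, hI⟩ := isUnit_euler.exists_right_inv
  rw [Nat.modEq_zero_iff_dvd, ← Int.natCast_dvd_natCast, tupleCoreCount_eq_coeff hI]
  obtain ⟨f, hf⟩ := iterate_dissect_eta_quotient hI m
  -- The index is n + 1 because 5^(m+2) (n + 1) - 4 is the required size; the shift by 4 is the
  -- factor X^4.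
  have h := congrArg (coeff (n + 1)) hf
  have h4 : 4 ≤ 5 ^ (m + 2) := by
    calc 4 ≤ 5 ^ 2 := by norm_num
      _ ≤ 5 ^ (m + 2) := Nat.pow_le_pow_right (by norm_num) (by omega)
  rw [coeff_iterate_dissect, show 5 ^ (m + 2) * (n + 1) =
      5 ^ (m + 1 + 1) * n + 5 ^ (m + 1 + 1) - 4 + 4 by
    rw [Nat.sub_add_cancel (h4.trans (Nat.le_add_left _ _))]; ring,
    show X ^ 4 * expand5 euler ^ 20 * I ^ 4 = X ^ 4 * (expand5 euler ^ 5 * I) ^ 4 by ring,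
    coeff_X_pow_mul] at h
  rw [h, show (5 ^ (m + 5) : ℤ⟦X⟧) = C (5 ^ (m + 5)) by rw [map_pow, map_ofNat], coeff_C_mul]
  push_cast
  exact dvd_mul_right _ _
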